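/- All locally convex spaces are real and Hausdorff. An (LF)-space is a strict inductive limit of an increasing sequence of Fréchet spaces, i.e. $E=\bigcup_n E_n$ with linear subspaces $E_n\subseteq E_{n+1}$, each $E_n$ carrying a Fréchet topology, $E_{n+1}$ inducing on $E_n$ its given topology, and $E$ carrying the finest locally convex topology making all inclusions $E_n\to E$ continuous. For locally convex spaces $E,F$, let $C^\infty(\mathbb R,E)$ be the space of smooth curves $c:\mathbb R\to E$ (all iterated derivatives exist), with the topology of uniform convergence on compact intervals of each derivative separately, and let $C^\infty(E,F)$ be the vector space of smooth maps, i.e. of all $f:E\to F$ such that $f\circ c$ is a smooth curve in $F$ for every smooth curve $c$ in $E$. For $f\in C^\infty(E,F)$ put $\mathrm d^0f(x)=f(x)$ and $$\mathrm d^{l+1}f(x)(w_0,\dots,w_l)=\tfrac{\partial}{\partial t}\Big|_{t=0}\,\mathrm d^{l}f(x+tw_0)(w_1,\dots,w_l).$$ The (C)-topology on $C^\infty(E,F)$ is the initial topology with respect to all maps $c^*:C^\infty(E,F)\to C^\infty(\mathbb R,F)$, $f\mapsto f\circ c$, with $c\in C^\infty(\mathbb R,E)$. The (D)-topology on $C^\infty(E,F)$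 is the topology of uniform convergence of the differentials $\mathrm d^lf$, for each order $l\in\mathbb N_0$ separately, on all sets $K\times B^l$ with $K\subseteq E$ compact and $B\subseteq E$ bounded. **Theorem.** Let $E$ be a Fréchet space or an (LF)-space and let $F$ be an arbitrary locally convex space. Then every (C)-bounded subset of $C^\infty(E,F)$ is (D)-bounded. Moreover, the (C)-topology and the (D)-topology on $C^\infty(E,F)$ have the same bounded sets. (A set is bounded for a topology if it is absorbed by every neighbourhood of zero.) -/

import Mathlib

open Filter Topology
open scoped UniformConvergence

namespace ConvenientCalculus

/-! ### Fréchet spaces and (LF)-spaces -/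

/-- `t` is a (Hausdorff or not) locally convex vector space topology on the real vector space `E`. -/
structure IsLocallyConvexTopology (E : Type*) [AddCommGroup E] [Module ℝ E]
    (t : TopologicalSpace E) : Prop where
  isTopologicalAddGroup : IsTopologicalAddGroup E
  continuousSMul : ContinuousSMul ℝ E
  locallyConvexSpace : LocallyConvexSpace ℝ E

/-- `t` is a Fréchet space topology on `E`: locally convex, metrizable, and complete
(for the uniform structure which every topological vector space carries). -/
structure IsFrechetTopology (E : Type*) [AddCommGroup E] [Module ℝ E]
    (t : TopologicalSpace E) : Prop extends IsLocallyConvexTopology E t where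
  metrizableSpace : TopologicalSpace.MetrizableSpace E
  completeSpace : @CompleteSpace E (IsTopologicalAddGroup.rightUniformSpace E)

/-- `t` is an (LF)-space topology on `E`: there is an increasing sequence of linear subspaces `S n`
with union `E`, each carrying a Fréchet topology `τ n`, such that `τ (n + 1)` induces `τ n` on `S n`
(strictness), and `t` is the finest locally convex topology on `E` for which all inclusions
`S n → E` are continuous. -/
def IsLFTopology (E : Type*) [AddCommGroup E] [Module ℝ E] (t : TopologicalSpace E) : Prop :=
  ∃ (S : ℕ → Submodule ℝ E) (hS : Monotone S) (τ : ∀ n, TopologicalSpace (S n)),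
    (∀ x : E, ∃ n, x ∈ S n) ∧
    (∀ n, IsFrechetTopology (S n) (τ n)) ∧
    (∀ n, τ n = (τ (n + 1)).induced (Submodule.inclusion (hS n.le_succ))) ∧
    IsLocallyConvexTopology E t ∧
    (∀ n, @Continuous (S n) E (τ n) t (S n).subtype) ∧
    ∀ t' : TopologicalSpace E, IsLocallyConvexTopology E t' →
      (∀ n, @Continuous (S n) E (τ n) t' (S n).subtype) → t ≤ t'

/-! ### Derivatives of curves -/

section Curves

variable {F : Type*} [AddCommGroup F] [Module ℝ F] [TopologicalSpace F]
  [IsTopologicalAddGroup F] [ContinuousSMul ℝ F]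

/-- In a topological vector space, the derivative of a curve is the limit of its difference
quotients. -/
theorem hasDerivAt_iff_tendsto_quotient {c : ℝ → F} {v : F} {t : ℝ} :
    HasDerivAt c v t ↔ Tendsto (fun s => (s - t)⁻¹ • (c s - c t)) (𝓝[≠] t) (𝓝 v) := by
  rw [HasDerivAt, HasDerivAtFilter]
  change HasFDerivAt c _ t ↔ _
  rw [hasFDerivAt_iff_isLittleOTVS,
    Asymptotics.isLittleOTVS_iff_tendsto_inv_smul (.of_forall fun s hs => by
      rw [sub_eq_zero.1 hs]; simp),
    ← tendsto_inf_principal_nhds_iff_of_forall_eq (s := {t}ᶜ) (by simp)]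
  change Tendsto _ (𝓝[≠] t) _ ↔ _
  rw [← tendsto_sub_nhds_zero_iff (x := v)]
  refine tendsto_congr' ?_
  filter_upwards [self_mem_nhdsWithin] with s hs
  have h : s - t ≠ 0 := sub_ne_zero.2 hs
  simp [smul_sub, inv_smul_smul₀ h]

theorem hasDerivAt_add {c d : ℝ → F} {v w : F} {t : ℝ} (hc : HasDerivAt c v t)
    (hd : HasDerivAt d w t) : HasDerivAt (c + d) (v + w) t := by
  rw [hasDerivAt_iff_tendsto_quotient] at *
  refine (hc.add hd).congr fun s => ?_
  simp only [Pi.add_apply, ← smul_add]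
  congr 1
  abel

theorem hasDerivAt_const_smul (a : ℝ) {c : ℝ → F} {v : F} {t : ℝ} (hc : HasDerivAt c v t) :
    HasDerivAt (a • c) (a • v) t := by
  rw [hasDerivAt_iff_tendsto_quotient] at *
  refine (hc.const_smul a).congr fun s => ?_
  simp only [Pi.smul_apply, ← smul_sub]
  rw [smul_comm]

theorem hasDerivAt_deriv {c : ℝ → F} {t : ℝ} (hc : DifferentiableAt ℝ c t) :
    HasDerivAt c (deriv c t) t := by
  obtain ⟨f', hf'⟩ := hc
  have h : ContinuousLinearMap.toSpanSingleton ℝ (deriv c t) = fderiv ℝ c t := by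
    ext
    simp [deriv]
  change HasFDerivAt c (ContinuousLinearMap.toSpanSingleton ℝ (deriv c t)) t
  rw [h]
  exact DifferentiableAt.hasFDerivAt ⟨f', hf'⟩

theorem differentiableAt_of_hasDerivAt {c : ℝ → F} {v : F} {t : ℝ} (hc : HasDerivAt c v t) :
    DifferentiableAt ℝ c t :=
  ⟨ContinuousLinearMap.toSpanSingleton ℝ v, hc⟩

theorem deriv_eq_of_hasDerivAt [T2Space F] {c c' : ℝ → F} (hc : ∀ t, HasDerivAt c (c' t) t) :
    deriv c = c' := by
  funext t
  exact tendsto_nhds_unique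
    (hasDerivAt_iff_tendsto_quotient.1 (hasDerivAt_deriv (differentiableAt_of_hasDerivAt (hc t))))
    (hasDerivAt_iff_tendsto_quotient.1 (hc t))

theorem hasDerivAt_zero (t : ℝ) : HasDerivAt (0 : ℝ → F) (0 : F) t :=
  hasDerivAt_iff_tendsto_quotient.2 (by simpa using tendsto_const_nhds)

/-- Smooth curves: all iterated derivatives exist. -/
def IsSmoothCurve (c : ℝ → F) : Prop := ∀ n : ℕ, Differentiable ℝ (deriv^[n] c)

variable [T2Space F]

theorem IsSmoothCurve.iterate_deriv_add {c d : ℝ → F} (hc : IsSmoothCurve c)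
    (hd : IsSmoothCurve d) (n : ℕ) : deriv^[n] (c + d) = deriv^[n] c + deriv^[n] d := by
  induction n with
  | zero => rfl
  | succ n ih =>
    simp only [Function.iterate_succ_apply']
    rw [ih]
    exact deriv_eq_of_hasDerivAt fun t => hasDerivAt_add (hasDerivAt_deriv (hc n t)) (hasDerivAt_deriv (hd n t))

theorem IsSmoothCurve.iterate_deriv_smul (a : ℝ) {c : ℝ → F} (hc : IsSmoothCurve c) (n : ℕ) :
    deriv^[n] (a • c) = a • deriv^[n] c := by
  induction n with
  | zero => rfl
  | succ n ih =>
    simp only [Function.iterate_succ_apply']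
    rw [ih]
    exact deriv_eq_of_hasDerivAt fun t => hasDerivAt_const_smul a (hasDerivAt_deriv (hc n t))

theorem IsSmoothCurve.add {c d : ℝ → F} (hc : IsSmoothCurve c) (hd : IsSmoothCurve d) :
    IsSmoothCurve (c + d) := fun n t => by
  rw [hc.iterate_deriv_add hd]
  exact differentiableAt_of_hasDerivAt
    (hasDerivAt_add (hasDerivAt_deriv (hc n t)) (hasDerivAt_deriv (hd n t)))

theorem IsSmoothCurve.smul (a : ℝ) {c : ℝ → F} (hc : IsSmoothCurve c) :
    IsSmoothCurve (a • c) := fun n t => by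
  rw [hc.iterate_deriv_smul a]
  exact differentiableAt_of_hasDerivAt (hasDerivAt_const_smul a (hasDerivAt_deriv (hc n t)))

theorem isSmoothCurve_zero : IsSmoothCurve (0 : ℝ → F) := fun n => by
  have h : deriv^[n] (0 : ℝ → F) = 0 := by
    induction n with
    | zero => rfl
    | succ n ih =>
      rw [Function.iterate_succ_apply', ih]
      exact deriv_eq_of_hasDerivAt hasDerivAt_zero
  rw [h]
  exact fun t => differentiableAt_of_hasDerivAt (hasDerivAt_zero t)

variable (F) in
/-- The vector space `C^∞(ℝ, F)` of smooth curves in `F`. -/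
def SmoothCurve : Submodule ℝ (ℝ → F) where
  carrier := {c | IsSmoothCurve c}
  add_mem' hc hd := IsSmoothCurve.add hc hd
  zero_mem' := isSmoothCurve_zero
  smul_mem' a _ hc := IsSmoothCurve.smul a hc

end Curves

/-- The topology of `C^∞(ℝ, F)`: uniform convergence on compact intervals of each derivative
separately. -/
@[reducible] noncomputable def smoothCurveTopology (F : Type*) [AddCommGroup F] [Module ℝ F] [UniformSpace F]
    [IsUniformAddGroup F] [ContinuousSMul ℝ F] [T2Space F] : TopologicalSpace (SmoothCurve F) :=
  ⨅ l : ℕ, TopologicalSpace.induced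
    (fun c : SmoothCurve F =>
      UniformOnFun.ofFun {I : Set ℝ | ∃ a b : ℝ, I = Set.Icc a b} (deriv^[l] (c : ℝ → F)))
    inferInstance

/-! ### Smooth maps between locally convex spaces -/

section Maps

variable {E : Type*} [AddCommGroup E] [Module ℝ E] [TopologicalSpace E]
  [IsTopologicalAddGroup E] [ContinuousSMul ℝ E] [T2Space E]
  {F : Type*} [AddCommGroup F] [Module ℝ F] [TopologicalSpace F]
  [IsTopologicalAddGroup F] [ContinuousSMul ℝ F] [T2Space F]

variable (E F) in
/-- The vector space `C^∞(E, F)` of smooth maps: those which take smooth curves in `E` to smooth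
curves in `F`. -/
def SmoothMap : Submodule ℝ (E → F) where
  carrier := {f | ∀ c : ℝ → E, IsSmoothCurve c → IsSmoothCurve (f ∘ c)}
  add_mem' hf hg c hc := IsSmoothCurve.add (hf c hc) (hg c hc)
  zero_mem' _ _ := isSmoothCurve_zero
  smul_mem' a _ hf c hc := IsSmoothCurve.smul a (hf c hc)

/-- The pullback `c^* : C^∞(E, F) → C^∞(ℝ, F)`, `f ↦ f ∘ c`, along a smooth curve `c` in `E`. -/
def SmoothMap.pullback (c : SmoothCurve E) (f : SmoothMap E F) : SmoothCurve F :=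
  ⟨(f : E → F) ∘ (c : ℝ → E), f.2 c c.2⟩

/-- The differential of order `l`, given by iterated directional derivatives: `d⁰f(x) = f(x)` and
`d^{l+1}f(x)(w₀, …, w_l) = ∂/∂t|_{t=0} d^l f(x + t w₀)(w₁, …, w_l)`. -/
noncomputable def iteratedDifferential (f : E → F) : (l : ℕ) → E → (Fin l → E) → F
  | 0, x, _ => f x
  | l + 1, x, w =>
    deriv (fun t : ℝ => iteratedDifferential f l (x + t • w 0) (Fin.tail w)) 0

end Maps

section Topologies

variable (E : Type*) [AddCommGroup E] [Module ℝ E] [TopologicalSpace E]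
  [IsTopologicalAddGroup E] [ContinuousSMul ℝ E] [T2Space E]
  (F : Type*) [AddCommGroup F] [Module ℝ F] [UniformSpace F]
  [IsUniformAddGroup F] [ContinuousSMul ℝ F] [T2Space F]

/-- The (C)-topology on `C^∞(E, F)`: the initial topology with respect to all pullbacks
`c^* : C^∞(E, F) → C^∞(ℝ, F)` along smooth curves `c` in `E`. -/
@[reducible] noncomputable def cTopology : TopologicalSpace (SmoothMap E F) :=
  ⨅ c : SmoothCurve E, (smoothCurveTopology F).induced (SmoothMap.pullback c)

/-- The sets `K × B^l ⊆ E × E^l` with `K` compact and `B` bounded. -/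
def compactTimesBounded (l : ℕ) : Set (Set (E × (Fin l → E))) :=
  {A | ∃ K B : Set E, IsCompact K ∧ Bornology.IsVonNBounded ℝ B ∧
    A = K ×ˢ {w : Fin l → E | ∀ i, w i ∈ B}}

/-- The (D)-topology on `C^∞(E, F)`: uniform convergence of the differentials of each order `l`
separately on the sets `K × B^l` with `K` compact and `B` bounded. -/
@[reducible] noncomputable def dTopology : TopologicalSpace (SmoothMap E F) :=
  ⨅ l : ℕ, TopologicalSpace.induced
    (fun f : SmoothMap E F => UniformOnFun.ofFun (compactTimesBounded E l)
      (fun p : E × (Fin l → E) => iteratedDifferential (f : E → F) l p.1 p.2))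
    inferInstance

variable {E F}

/-- (C)-bounded subsets of `C^∞(E, F)`: bounded (absorbed by every neighbourhood of zero) in the
(C)-topology. -/
def IsCBounded (B : Set (SmoothMap E F)) : Prop :=
  @Bornology.IsVonNBounded ℝ (SmoothMap E F) _ _ _ (cTopology E F) B

/-- (D)-bounded subsets of `C^∞(E, F)`: bounded (absorbed by every neighbourhood of zero) in the
(D)-topology. -/
def IsDBounded (B : Set (SmoothMap E F)) : Prop :=
  @Bornology.IsVonNBounded ℝ (SmoothMap E F) _ _ _ (dTopology E F) B

end Topologies

end ConvenientCalculus

/-! Only one property of `E` matters, `FastSequentiallyCompact`: a sequence in a compact set has a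
subsequence whose distance to some point stays bounded after division by `2 ^ (-n ^ 2)`. In a
metrizable space a diagonal choice gives it. In an (LF)-space a compact set lies in one step
(`exists_subset_range_of_isVonNBounded`) and the steps are topologically embedded
(`isInducing_of_strict`), so the metrizable case applies there.

From (C) to (D): if the `l`-fold directional derivatives of a family were unbounded on `K × W`, pick
violating maps, points and directions and pass to a fast subsequence. A single smooth curve runs
through these points at times `2 ^ (-n)`, affinely and in the chosen directions
(`exists_special_curve`), and the family is unbounded along it (`exists_bound_pure_derivative`).
Polarization passes from pure to mixed differentials. That the mixed differentials exist and are
given by polarization is Boman's theorem (`contDiff_of_comp_smoothCurve`) on finite-dimensional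
slices, applied after composing with functionals; `hasDerivAt_of_dual` returns to `F` by Mackey's
theorem. Boman's theorem itself follows from the same curve argument, which makes pure derivatives
locally bounded and hence continuous, together with mollification.

From (D) to (C): the `l`-th derivative of `g ∘ c` at a point depends only on the `l`-jet of `c`
(`iterate_deriv_comp_eq_taylor`). So `c` may be replaced by its Taylor polynomial, and `g ∘ c` by a
smooth function on `ℝ ^ l` composed with the moment curve. The bound for derivatives of a
composition then involves only differentials of `g` at points of `c`, evaluated on Taylor
coefficients, which range over a compact set (`exists_bound_along_curve`). -/

namespace ConvenientCalculus

/-! ### Bounded sets in locally convex spaces -/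

/-- Uniform boundedness in a seminormed space: weakly bounded families are bounded. -/
theorem exists_norm_le_of_weakly_bounded {X ι : Type*} [SeminormedAddCommGroup X]
    [NormedSpace ℝ X] (a : ι → X)
    (h : ∀ f : X →ₗ[ℝ] ℝ, (∃ C, ∀ x, |f x| ≤ C * ‖x‖) → ∃ C, ∀ i, |f (a i)| ≤ C) :
    ∃ C, ∀ i, ‖a i‖ ≤ C := by
  -- Evaluations act on the dual, which is complete even if `X` is not; the embedding into the
  -- bidual is isometric.
  obtain ⟨C, hC⟩ := banach_steinhaus (g := fun i => NormedSpace.inclusionInDoubleDual ℝ X (a i))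
    (fun f => h f.toLinearMap ⟨‖f‖, fun x => f.le_opNorm x⟩)
  refine ⟨C, fun i => ?_⟩
  have := (NormedSpace.inclusionInDoubleDualLi ℝ (E := X)).norm_map (a i)
  rw [← this]
  exact hC i

section Bounded

variable {F : Type*} [AddCommGroup F] [Module ℝ F] [TopologicalSpace F]
  [IsTopologicalAddGroup F] [ContinuousSMul ℝ F] [LocallyConvexSpace ℝ F]

theorem isVonNBounded_range_iff_seminorm {ι : Type*} (a : ι → F) :
    Bornology.IsVonNBounded ℝ (Set.range a) ↔
      ∀ p : Seminorm ℝ F, Continuous p → ∃ C, ∀ i, p (a i) ≤ C := by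
  rw [(PolynormableSpace.withSeminorms ℝ F).isVonNBounded_iff_seminorm_bddAbove]
  simp [BddAbove, Set.Nonempty, upperBounds]

theorem isVonNBounded_iff_seminorm {A : Set F} :
    Bornology.IsVonNBounded ℝ A ↔
      ∀ p : Seminorm ℝ F, Continuous p → ∃ C, ∀ x ∈ A, p x ≤ C := by
  rw [← Subtype.range_coe (s := A), isVonNBounded_range_iff_seminorm]
  simp

/-- Mackey's theorem: weakly bounded families in a locally convex space are bounded. -/
theorem isVonNBounded_range_iff_dual {ι : Type*} (a : ι → F) :
    Bornology.IsVonNBounded ℝ (Set.range a) ↔ ∀ f : F →L[ℝ] ℝ, ∃ C, ∀ i, |f (a i)| ≤ C := by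
  rw [isVonNBounded_range_iff_seminorm]
  refine ⟨fun h f => h ((normSeminorm ℝ ℝ).comp f.toLinearMap) (continuous_norm.comp f.continuous),
    fun h p hp => ?_⟩
  -- Functionals dominated by `p` are continuous for the original topology. This has to be settled
  -- before `p` becomes the norm of `F`.
  have key (f : F →ₗ[ℝ] ℝ) (hf : ∃ C, ∀ x, |f x| ≤ C * p x) : Continuous f := by
    obtain ⟨C, hC⟩ := hf
    have h0 : Tendsto f (𝓝 0) (𝓝 0) := by
      refine squeeze_zero_norm hC ?_
      simpa using (hp.tendsto 0).const_mul C
    exact continuous_of_continuousAt_zero f (by simpa [ContinuousAt] using h0)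
  let _ : SeminormedAddCommGroup F := p.toAddGroupSeminorm.toSeminormedAddCommGroup
  let _ : NormedSpace ℝ F := { ‹Module ℝ F› with norm_smul_le := fun r x => (map_smul_eq_mul p r x).le }
  exact exists_norm_le_of_weakly_bounded a fun f hf => h ⟨f, key f hf⟩

end Bounded

/-! ### Curves in topological vector spaces -/

section Curves

variable {F : Type*} [AddCommGroup F] [Module ℝ F] [TopologicalSpace F]
  [IsTopologicalAddGroup F] [ContinuousSMul ℝ F]

theorem hasDerivAt_const_curve (x : F) (t : ℝ) : HasDerivAt (fun _ : ℝ => x) 0 t :=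
  hasDerivAt_iff_tendsto_quotient.2 (by simpa using tendsto_const_nhds)

theorem continuous_of_hasDerivAt {c v : ℝ → F} (hc : ∀ t, HasDerivAt c (v t) t) :
    Continuous c := by
  refine continuous_iff_continuousAt.2 fun t => ?_
  rw [continuousAt_iff_punctured_nhds, ← tendsto_sub_nhds_zero_iff]
  have h := hasDerivAt_iff_tendsto_quotient.1 (hc t)
  have h1 : Tendsto (fun s : ℝ => s - t) (𝓝[≠] t) (𝓝 0) :=
    tendsto_nhdsWithin_of_tendsto_nhds (Continuous.tendsto' (by fun_prop) _ _ (by simp))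
  have h2 := h1.smul h
  rw [zero_smul] at h2
  refine h2.congr' ?_
  filter_upwards [self_mem_nhdsWithin] with s hs
  rw [smul_inv_smul₀ (sub_ne_zero.2 hs)]

/-- A first order expansion whose remainder is quadratic up to a bounded factor gives the
derivative. -/
theorem hasDerivAt_of_isVonNBounded {c : ℝ → F} {v : F} {t : ℝ}
    (h : Bornology.IsVonNBounded ℝ (Set.range fun s : Set.Icc (t - 1) (t + 1) =>
      (((s : ℝ) - t) ^ 2)⁻¹ • (c s - c t - ((s : ℝ) - t) • v))) : HasDerivAt c v t := by
  rw [hasDerivAt_iff_tendsto_quotient, ← tendsto_sub_nhds_zero_iff]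
  have h1 : Tendsto (fun s : ℝ => s - t) (𝓝[≠] t) (𝓝 0) :=
    tendsto_nhdsWithin_of_tendsto_nhds (Continuous.tendsto' (by fun_prop) _ _ (by simp))
  have h2 : ∀ᶠ s in 𝓝[≠] t, s ∈ Set.Icc (t - 1) (t + 1) :=
    nhdsWithin_le_nhds (Icc_mem_nhds (by linarith) (by linarith))
  refine (h.smul_tendsto_zero (x := fun s => ((s - t) ^ 2)⁻¹ • (c s - c t - (s - t) • v))
    (h2.mono fun s hs => ⟨⟨s, hs⟩, rfl⟩) h1).congr' ?_
  filter_upwards [self_mem_nhdsWithin] with s hs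
  have hs' : s - t ≠ 0 := sub_ne_zero.2 hs
  simp only [Pi.smul_apply', smul_smul]
  rw [smul_sub, smul_smul]
  congr 2 <;> field_simp
  rw [one_smul]

/-- A curve in a normed space is smooth in this sense iff it is `C^∞`. -/
theorem isSmoothCurve_iff_contDiff {V : Type*} [NormedAddCommGroup V] [NormedSpace ℝ V]
    {c : ℝ → V} : IsSmoothCurve c ↔ ContDiff ℝ (⊤ : ℕ∞) c := by
  rw [contDiff_iff_iteratedDeriv]
  simp only [IsSmoothCurve, iteratedDeriv_eq_iterate]
  exact ⟨fun h => ⟨fun m _ => (h m).continuous, fun m _ => h m⟩,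
    fun h n => h.2 n (by exact_mod_cast ENat.natCast_lt_top n)⟩

theorem HasDerivAt.dual_comp {c : ℝ → F} {v : F} {t : ℝ} (hc : HasDerivAt c v t)
    {G : Type*} [AddCommGroup G] [Module ℝ G] [TopologicalSpace G] [IsTopologicalAddGroup G]
    [ContinuousSMul ℝ G] (L : F →L[ℝ] G) : HasDerivAt (fun s => L (c s)) (L v) t := by
  rw [hasDerivAt_iff_tendsto_quotient] at *
  simpa [Function.comp_def] using (L.continuous.tendsto v).comp hc

variable [T2Space F]

theorem IsSmoothCurve.hasDerivAt {c : ℝ → F} (hc : IsSmoothCurve c) (n : ℕ) (t : ℝ) :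
    HasDerivAt (deriv^[n] c) (deriv^[n + 1] c t) t := by
  rw [Function.iterate_succ_apply']
  exact hasDerivAt_deriv (hc n t)

theorem iterate_deriv_eq_of_hasDerivAt {c : ℕ → ℝ → F}
    (h : ∀ n t, HasDerivAt (c n) (c (n + 1) t) t) (n : ℕ) : deriv^[n] (c 0) = c n := by
  induction n with
  | zero => rfl
  | succ n ih => rw [Function.iterate_succ_apply', ih, deriv_eq_of_hasDerivAt (h n)]

/-- A curve with a sequence of successive derivatives is smooth. -/
theorem isSmoothCurve_of_hasDerivAt {c : ℕ → ℝ → F}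
    (h : ∀ n t, HasDerivAt (c n) (c (n + 1) t) t) : IsSmoothCurve (c 0) := fun n t => by
  rw [iterate_deriv_eq_of_hasDerivAt h]
  exact differentiableAt_of_hasDerivAt (h n t)

theorem IsSmoothCurve.clm_comp {c : ℝ → F} (hc : IsSmoothCurve c)
    {G : Type*} [AddCommGroup G] [Module ℝ G] [TopologicalSpace G] [IsTopologicalAddGroup G]
    [ContinuousSMul ℝ G] [T2Space G] (L : F →L[ℝ] G) :
    IsSmoothCurve (fun t => L (c t)) :=
  isSmoothCurve_of_hasDerivAt (c := fun n t => L (deriv^[n] c t))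
    fun n t => HasDerivAt.dual_comp (hc.hasDerivAt n t) L

theorem IsSmoothCurve.iterate_deriv_clm_comp {c : ℝ → F} (hc : IsSmoothCurve c)
    {G : Type*} [AddCommGroup G] [Module ℝ G] [TopologicalSpace G] [IsTopologicalAddGroup G]
    [ContinuousSMul ℝ G] [T2Space G] (L : F →L[ℝ] G) (n : ℕ) :
    deriv^[n] (fun t => L (c t)) = fun t => L (deriv^[n] c t) :=
  iterate_deriv_eq_of_hasDerivAt (c := fun n t => L (deriv^[n] c t))
    (fun n t => HasDerivAt.dual_comp (hc.hasDerivAt n t) L) n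

theorem IsSmoothCurve.continuous_iterate_deriv {c : ℝ → F} (hc : IsSmoothCurve c) (n : ℕ) :
    Continuous (deriv^[n] c) :=
  continuous_of_hasDerivAt (hc.hasDerivAt n)

theorem isSmoothCurve_const (x : F) : IsSmoothCurve (fun _ : ℝ => x) :=
  isSmoothCurve_of_hasDerivAt (c := fun n _ => if n = 0 then x else 0) fun n t => by
    simpa using hasDerivAt_const_curve _ t

/-- Smooth scalar functions times a fixed vector. -/
theorem isSmoothCurve_smul_const {φ : ℝ → ℝ} (h : IsSmoothCurve φ) (w : F) :
    IsSmoothCurve (fun s => φ s • w) :=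
  h.clm_comp (ContinuousLinearMap.toSpanSingleton ℝ w)

theorem isSmoothCurve_line (x w : F) : IsSmoothCurve (fun t : ℝ => x + t • w) :=
  (isSmoothCurve_const x).add
    (isSmoothCurve_smul_const (φ := fun t => t) (isSmoothCurve_iff_contDiff.2 contDiff_id) w)

/-- The mean value inequality is applied twice, to `f'` and then to `f r - r * f' t`; the sharp
factor `1 / 2` is not needed. -/
theorem abs_sub_sub_le_of_second_deriv {f f' f'' : ℝ → ℝ} {C s t : ℝ}
    (h1 : ∀ x, HasDerivAt f (f' x) x) (h2 : ∀ x, HasDerivAt f' (f'' x) x)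
    (hC : ∀ x ∈ Set.uIcc t s, |f'' x| ≤ C) :
    |f s - f t - (s - t) * f' t| ≤ C * |s - t| ^ 2 := by
  have hC0 : 0 ≤ C := (abs_nonneg _).trans (hC t Set.left_mem_uIcc)
  have h3 : ∀ r ∈ Set.uIcc t s, |f' r - f' t| ≤ C * |s - t| := fun r hr => by
    have := (convex_uIcc t s).norm_image_sub_le_of_norm_hasDerivWithin_le
      (fun x _ => (h2 x).hasDerivWithinAt) hC Set.left_mem_uIcc hr
    refine this.trans ?_
    gcongr
    exact Set.abs_sub_left_of_mem_uIcc hr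
  have h4 := (convex_uIcc t s).norm_image_sub_le_of_norm_hasDerivWithin_le
      (f := fun r => f r - r * f' t) (f' := fun r => f' r - f' t)
      (fun x _ => ((h1 x).sub ((hasDerivAt_id x).mul_const (f' t) |>.congr_deriv
        (one_mul _))).hasDerivWithinAt) h3 Set.left_mem_uIcc Set.right_mem_uIcc
  calc _ = ‖f s - s * f' t - (f t - t * f' t)‖ := by
        rw [Real.norm_eq_abs]; congr 1; ring
    _ ≤ _ := h4
    _ = _ := by rw [Real.norm_eq_abs]; ring

/-- A curve which is weakly twice differentiable, with weak derivatives represented by curves in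
the space, is differentiable. -/
theorem hasDerivAt_of_dual [LocallyConvexSpace ℝ F] {c v a : ℝ → F}
    (hc : ∀ (L : F →L[ℝ] ℝ) (t : ℝ), HasDerivAt (fun s => L (c s)) (L (v t)) t)
    (hv : ∀ (L : F →L[ℝ] ℝ) (t : ℝ), HasDerivAt (fun s => L (v s)) (L (a t)) t)
    (ha : ∀ L : F →L[ℝ] ℝ, Continuous fun s => L (a s)) (t : ℝ) : HasDerivAt c (v t) t := by
  -- By Mackey's theorem the rescaled remainders need only be bounded under each functional, where
  -- this is a second order estimate.
  refine hasDerivAt_of_isVonNBounded ((isVonNBounded_range_iff_dual _).2 fun L => ?_)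
  obtain ⟨C, hC⟩ := isCompact_Icc (a := t - 1) (b := t + 1) |>.exists_bound_of_continuousOn
    (ha L).continuousOn
  have hC0 : 0 ≤ C := (norm_nonneg _).trans (hC t (by constructor <;> linarith))
  refine ⟨C, fun ⟨s, hs⟩ => ?_⟩
  have h := abs_sub_sub_le_of_second_deriv (hc L) (hv L) (C := C) (s := s) (t := t) fun x hx =>
    hC x (Set.uIcc_subset_Icc (by constructor <;> linarith) hs hx)
  rcases eq_or_ne s t with rfl | hne
  · simpa using hC0
  have hpos : 0 < |s - t| ^ 2 := by have := abs_pos.2 (sub_ne_zero.2 hne); positivity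
  simp only [map_smul, map_sub, smul_eq_mul, abs_mul, abs_inv, abs_pow]
  rw [inv_mul_le_iff₀ hpos, mul_comm (_ ^ 2)]
  exact h

end Curves

/-! ### Smooth curves through fast converging sequences -/

theorem HasDerivAt.comp_affine {F : Type*} [AddCommGroup F] [Module ℝ F] [TopologicalSpace F]
    [IsTopologicalAddGroup F] [ContinuousSMul ℝ F] {c : ℝ → F} {v : F} {a b t : ℝ} (ha : a ≠ 0)
    (hc : HasDerivAt c v (a * t + b)) : HasDerivAt (fun s => c (a * s + b)) (a • v) t := by
  rw [hasDerivAt_iff_tendsto_quotient] at *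
  have h1 : Tendsto (fun s => a * s + b) (𝓝[≠] t) (𝓝[≠] (a * t + b)) := by
    refine tendsto_nhdsWithin_iff.2 ⟨tendsto_nhdsWithin_of_tendsto_nhds
      (Continuous.tendsto (by fun_prop) _), ?_⟩
    filter_upwards [self_mem_nhdsWithin] with s hs
    simpa [ha] using hs
  refine ((hc.comp h1).const_smul a).congr' ?_
  filter_upwards [self_mem_nhdsWithin] with s hs
  have hs' : s - t ≠ 0 := sub_ne_zero.2 hs
  simp only [Function.comp_apply, smul_smul]
  congr 1
  rw [show a * s + b - (a * t + b) = a * (s - t) by ring]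
  field_simp

theorem IsSmoothCurve.iterate_deriv_comp_affine {F : Type*} [AddCommGroup F] [Module ℝ F]
    [TopologicalSpace F] [IsTopologicalAddGroup F] [ContinuousSMul ℝ F] [T2Space F] {c : ℝ → F}
    (hc : IsSmoothCurve c) {a : ℝ} (ha : a ≠ 0) (b : ℝ) (n : ℕ) :
    deriv^[n] (fun s => c (a * s + b)) = fun s => a ^ n • deriv^[n] c (a * s + b) := by
  have := iterate_deriv_eq_of_hasDerivAt (c := fun n s => a ^ n • deriv^[n] c (a * s + b))
    (fun n t => by
      have := hasDerivAt_const_smul (a ^ n) (HasDerivAt.comp_affine ha (hc.hasDerivAt n (a * t + b)))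
      rwa [smul_smul, ← pow_succ] at this) n
  simpa using this

theorem IsSmoothCurve.comp_affine {F : Type*} [AddCommGroup F] [Module ℝ F]
    [TopologicalSpace F] [IsTopologicalAddGroup F] [ContinuousSMul ℝ F] [T2Space F] {c : ℝ → F}
    (hc : IsSmoothCurve c) {a : ℝ} (ha : a ≠ 0) (b : ℝ) :
    IsSmoothCurve (fun s => c (a * s + b)) := by
  have := isSmoothCurve_of_hasDerivAt (c := fun n s => a ^ n • deriv^[n] c (a * s + b))
    (fun n t => by
      have := hasDerivAt_const_smul (a ^ n) (HasDerivAt.comp_affine ha (hc.hasDerivAt n (a * t + b)))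
      rwa [smul_smul, ← pow_succ] at this)
  simpa using this

theorem IsSmoothCurve.eventuallyEq_iterate_deriv {F : Type*} [AddCommGroup F] [Module ℝ F]
    [TopologicalSpace F] [IsTopologicalAddGroup F] [ContinuousSMul ℝ F] [T2Space F] {c d : ℝ → F}
    {t : ℝ} (hc : IsSmoothCurve c) (hd : IsSmoothCurve d) (h : c =ᶠ[𝓝 t] d) (n : ℕ) :
    deriv^[n] c =ᶠ[𝓝 t] deriv^[n] d := by
  induction n with
  | zero => exact h
  | succ n ih =>
    filter_upwards [ih.eventuallyEq_nhds] with s hs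
    have h1 := hasDerivAt_iff_tendsto_quotient.1 (hc.hasDerivAt n s)
    have h2 := hasDerivAt_iff_tendsto_quotient.1 (hd.hasDerivAt n s)
    refine tendsto_nhds_unique (h1.congr' ?_) h2
    filter_upwards [nhdsWithin_le_nhds hs] with r hr
    rw [hr, hs.eq_of_nhds]

section LocallyConvex

variable {E : Type*} [AddCommGroup E] [Module ℝ E] [TopologicalSpace E]
  [IsTopologicalAddGroup E] [ContinuousSMul ℝ E] [LocallyConvexSpace ℝ E]

/-- Superposition of scalar smooth functions with disjoint supports and uniformly bounded
derivatives, along a bounded sequence of vectors. -/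
theorem isSmoothCurve_finsum [T2Space E] {θ : ℕ → ℕ → ℝ → ℝ} {J : ℕ → Set ℝ} {u : ℕ → E}
    (hθ : ∀ k n t, HasDerivAt (θ k n) (θ (k + 1) n t) t)
    (hM : ∀ k, ∃ M, ∀ n t, |θ k n t| ≤ M) (hJ : ∀ m n t, t ∈ J m → t ∈ J n → m = n)
    (hθJ : ∀ k n t, t ∉ J n → θ k n t = 0) (hu : Bornology.IsVonNBounded ℝ (Set.range u)) :
    IsSmoothCurve fun t => ∑ᶠ n, θ 0 n t • u n := by
  refine isSmoothCurve_of_hasDerivAt (c := fun k t => ∑ᶠ n, θ k n t • u n) fun k t => ?_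
  refine hasDerivAt_of_isVonNBounded ((isVonNBounded_range_iff_seminorm _).2 fun p hp => ?_)
  obtain ⟨C, hC⟩ := (isVonNBounded_range_iff_seminorm _).1 hu p hp
  obtain ⟨M, hM⟩ := hM (k + 2)
  have hM0 : 0 ≤ M := (abs_nonneg _).trans (hM 0 0)
  have hC0 : 0 ≤ C := (apply_nonneg p _).trans (hC 0)
  -- By disjointness at most one summand survives at `t` and one at `s`. This makes the sums finite
  -- and explains the factor `2` in the bound.
  have hT (t : ℝ) : ∃ n, ∀ m, m ≠ n → t ∉ J m := by
    by_cases h : ∃ n, t ∈ J n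
    · obtain ⟨n, hn⟩ := h
      exact ⟨n, fun m hmn hm => hmn (hJ m n t hm hn)⟩
    · push Not at h
      exact ⟨0, fun m _ => h m⟩
  refine ⟨2 * (M * C), fun ⟨s, hs⟩ => ?_⟩
  obtain ⟨m, hm⟩ := hT t
  obtain ⟨n, hn⟩ := hT s
  have hsum (k : ℕ) {r : ℝ} (hr : ∀ i, i ∉ ({m, n} : Finset ℕ) → r ∉ J i) :
      ∑ᶠ i, θ k i r • u i = ∑ i ∈ {m, n}, θ k i r • u i := by
    refine finsum_eq_sum_of_support_subset _ fun i hi => ?_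
    by_contra hi'
    exact hi (by simp [hθJ k i r (hr i (by simpa using hi'))])
  have ht' : ∀ i, i ∉ ({m, n} : Finset ℕ) → t ∉ J i := fun i hi => hm i (by simp at hi; tauto)
  have hs' : ∀ i, i ∉ ({m, n} : Finset ℕ) → s ∉ J i := fun i hi => hn i (by simp at hi; tauto)
  simp only [hsum _ ht', hsum _ hs', Finset.smul_sum, ← Finset.sum_sub_distrib, smul_smul,
    ← sub_smul]
  have hterm (i : ℕ) : p ((((s - t) ^ 2)⁻¹ * (θ k i s - θ k i t - (s - t) * θ (k + 1) i t)) • u i)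
      ≤ M * C := by
    rw [map_smul_eq_mul]
    have h := abs_sub_sub_le_of_second_deriv (hθ k i) (hθ (k + 1) i) (s := s) (t := t)
      fun x _ => hM i x
    refine mul_le_mul ?_ (hC i) (apply_nonneg _ _) hM0
    rcases eq_or_ne s t with rfl | hne
    · simpa using hM0
    have hpos : 0 < |s - t| ^ 2 := by have := abs_pos.2 (sub_ne_zero.2 hne); positivity
    rw [norm_mul, norm_inv, norm_pow, Real.norm_eq_abs, Real.norm_eq_abs, inv_mul_le_iff₀ hpos,
      mul_comm (_ ^ 2)]
    exact h
  refine (Finset.le_sum_of_subadditive p (map_zero p).le (map_add_le_add p) _ _).trans ?_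
  refine (Finset.sum_le_card_nsmul _ _ _ fun i _ => hterm i).trans ?_
  rw [nsmul_eq_mul]
  have : (({m, n} : Finset ℕ).card : ℝ) ≤ 2 := by exact_mod_cast Finset.card_le_two
  gcongr

/-- The weights `2 ^ (-n ^ 2)` of a fast converging sequence. -/
noncomputable def fastWeight (n : ℕ) : ℝ := ((2 : ℝ) ^ (n ^ 2))⁻¹

theorem fastWeight_pos (n : ℕ) : 0 < fastWeight n := by unfold fastWeight; positivity

/-- Since `n k ≤ n ^ 2 + k ^ 2`. The factor `(2 ^ n) ^ k` is the cost of differentiating a bump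
rescaled by `2 ^ n` exactly `k` times, and the weight absorbs it uniformly in `n`. -/
theorem fastWeight_mul_le (n k : ℕ) : fastWeight n * (2 ^ n) ^ k ≤ 2 ^ (k ^ 2) := by
  unfold fastWeight
  rw [inv_mul_le_iff₀ (by positivity), ← pow_mul, ← pow_add]
  refine pow_le_pow_right₀ (by norm_num) ?_
  nlinarith [sq_nonneg ((n : ℤ) - k), Nat.le_or_le n k]

/-- The windows are `2 ^ (-n) * [3/4, 5/4]`, and they are disjoint because `5/4 < 2 * (3/4)`. -/
theorem eq_of_mem_dyadic {m n : ℕ} {t : ℝ}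
    (hm : 2 ^ m * t + (-1) ∈ Metric.closedBall (0 : ℝ) (1 / 4))
    (hn : 2 ^ n * t + (-1) ∈ Metric.closedBall (0 : ℝ) (1 / 4)) : m = n := by
  have key : ∀ m n : ℕ, m < n → 2 ^ m * t + (-1) ∈ Metric.closedBall (0 : ℝ) (1 / 4) →
      2 ^ n * t + (-1) ∈ Metric.closedBall (0 : ℝ) (1 / 4) → False := fun m n hmn h1 h2 => by
    simp only [Metric.mem_closedBall, dist_zero_right, Real.norm_eq_abs, abs_le] at h1 h2
    obtain ⟨d, rfl⟩ := Nat.exists_eq_add_of_lt hmn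
    have : (1 : ℝ) ≤ 2 ^ d := one_le_pow₀ (by norm_num)
    rw [show m + d + 1 = m + (d + 1) by ring, pow_add, pow_succ] at h2
    nlinarith
  rcases lt_trichotomy m n with hmn | hmn | hmn
  · exact (key m n hmn hm hn).elim
  · exact hmn
  · exact (key n m hmn hn hm).elim

/-- The bumps live in disjoint windows around `2 ^ (-n)`, and `fastWeight` keeps each order of
derivative bounded uniformly in `n`, so smoothness holds even at the accumulation point `0`. -/
theorem isSmoothCurve_rescaled_sum [T2Space E] {ψ : ℝ → ℝ} (hψ : IsSmoothCurve ψ)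
    (hψ0 : tsupport ψ ⊆ Metric.closedBall 0 (1 / 4)) {u : ℕ → E}
    (hu : Bornology.IsVonNBounded ℝ (Set.range u)) :
    IsSmoothCurve fun t => ∑ᶠ n, (fastWeight n * ψ (2 ^ n * t + (-1))) • u n := by
  have hsupp (k : ℕ) : tsupport (deriv^[k] ψ) ⊆ Metric.closedBall 0 (1 / 4) := by
    induction k with
    | zero => exact hψ0
    | succ k ih =>
      rw [Function.iterate_succ_apply']
      exact (closure_minimal support_deriv_subset (isClosed_tsupport _)).trans ih
  have h := isSmoothCurve_finsum
    (θ := fun k n t => fastWeight n * (2 ^ n) ^ k * deriv^[k] ψ (2 ^ n * t + (-1)))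
    (J := fun n => {t | 2 ^ n * t + (-1) ∈ Metric.closedBall (0 : ℝ) (1 / 4)}) (u := u)
    (fun k n t => ?_) (fun k => ?_) (fun m n t hm hn => ?_) (fun k n t ht => ?_) hu
  · simpa using h
  · have := hasDerivAt_const_smul (fastWeight n * (2 ^ n) ^ k) (HasDerivAt.comp_affine (a := 2 ^ n)
      (b := -1) (t := t) (by positivity) (hψ.hasDerivAt k _))
    refine HasDerivAt.congr_deriv this ?_
    simp only [smul_eq_mul]; ring
  · obtain ⟨C, hC⟩ := HasCompactSupport.exists_bound_of_continuous (f := deriv^[k] ψ)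
      (HasCompactSupport.of_support_subset_isCompact (isCompact_closedBall 0 (1 / 4))
        (subset_closure.trans (hsupp k))) (hψ.continuous_iterate_deriv k)
    refine ⟨2 ^ (k ^ 2) * C, fun n t => ?_⟩
    rw [abs_mul, abs_of_nonneg (by have := fastWeight_pos n; positivity)]
    exact mul_le_mul (fastWeight_mul_le n k) (hC _) (abs_nonneg _) (by positivity)
  · exact eq_of_mem_dyadic hm hn
  · rw [image_eq_zero_of_notMem_tsupport fun h => ht (hsupp k h), mul_zero]

theorem rescaled_sum_eq {ψ : ℝ → ℝ} (hψ0 : tsupport ψ ⊆ Metric.closedBall 0 (1 / 4)) (u : ℕ → E)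
    {n : ℕ} {t : ℝ} (ht : 2 ^ n * t + (-1) ∈ Metric.closedBall (0 : ℝ) (1 / 4)) :
    ∑ᶠ n, (fastWeight n * ψ (2 ^ n * t + (-1))) • u n =
      (fastWeight n * ψ (2 ^ n * t + (-1))) • u n := by
  refine finsum_eq_single _ n fun m hm => ?_
  rw [image_eq_zero_of_notMem_tsupport fun h => hm (eq_of_mem_dyadic (hψ0 h) ht), mul_zero,
    zero_smul]

/-- The special curve lemma: there is a smooth curve which runs affinely through the points
`x + fastWeight n • u n` with velocities proportional to `w n`. -/
theorem exists_special_curve [T2Space E] (x : E) {u w : ℕ → E}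
    (hu : Bornology.IsVonNBounded ℝ (Set.range u)) (hw : Bornology.IsVonNBounded ℝ (Set.range w)) :
    ∃ c : ℝ → E, IsSmoothCurve c ∧ ∀ n : ℕ, ∀ᶠ t in 𝓝 ((2 : ℝ) ^ n)⁻¹,
      c t = x + fastWeight n • u n + (fastWeight n * 2 ^ n * t + -fastWeight n) • w n := by
  -- The bump is `1` on the ball of radius `1 / 8`, so near `2 ^ (-n)` the weights `f` and `t * f t`
  -- become `1` and `t`: the first places the curve at the point, the second gives the velocity.
  let f : ContDiffBump (0 : ℝ) := ⟨1 / 8, 1 / 4, by norm_num, by norm_num⟩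
  have hf : tsupport f ⊆ Metric.closedBall 0 (1 / 4) := f.tsupport_eq.le
  have hg : tsupport (fun t => t * f t) ⊆ Metric.closedBall 0 (1 / 4) :=
    (tsupport_mul_subset_right (f := fun t => t) (g := f)).trans hf
  have hfs : IsSmoothCurve f := isSmoothCurve_iff_contDiff.2 f.contDiff
  have hgs : IsSmoothCurve (fun t => t * f t) :=
    isSmoothCurve_iff_contDiff.2 (contDiff_id.mul f.contDiff)
  refine ⟨_, ((isSmoothCurve_const x).add (isSmoothCurve_rescaled_sum hfs hf hu)).add
    (isSmoothCurve_rescaled_sum hgs hg hw), fun n => ?_⟩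
  have hev : ∀ᶠ t in 𝓝 ((2 : ℝ) ^ n)⁻¹, 2 ^ n * t + (-1) ∈ Metric.ball (0 : ℝ) (1 / 8) := by
    refine Continuous.tendsto' (f := fun t : ℝ => (2 : ℝ) ^ n * t + (-1)) (by fun_prop) _ 0 ?_
      |>.eventually (Metric.ball_mem_nhds _ (by norm_num))
    field_simp
    simp
  filter_upwards [hev] with t ht
  have ht1 : 2 ^ n * t + (-1) ∈ Metric.closedBall (0 : ℝ) (1 / 4) :=
    Metric.closedBall_subset_closedBall (by norm_num) (Metric.ball_subset_closedBall ht)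
  have hft : f (2 ^ n * t + (-1)) = 1 := f.one_of_mem_closedBall (Metric.ball_subset_closedBall ht)
  simp only [Pi.add_apply]
  rw [rescaled_sum_eq hf u ht1, rescaled_sum_eq hg w ht1, hft]
  congr 2 <;> ring_nf

/-- Every sequence in `K` has a subsequence converging at the rate `fastWeight`. -/
def FastSequentiallyCompact (K : Set E) : Prop :=
  ∀ y : ℕ → E, (∀ n, y n ∈ K) → ∃ x : E, ∃ φ : ℕ → ℕ, StrictMono φ ∧
    Bornology.IsVonNBounded ℝ (Set.range fun n => (fastWeight n)⁻¹ • (y (φ n) - x))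

-- With a countable neighbourhood base, the `n`-th term can be chosen so late that its rescaled
-- error lies in the `n`-th basic neighbourhood. The rescaled errors then tend to zero, so they are
-- bounded.
omit [LocallyConvexSpace ℝ E] in
theorem IsCompact.fastSequentiallyCompact [FirstCountableTopology E] {K : Set E}
    (hK : IsCompact K) : FastSequentiallyCompact K := fun y hy => by
  obtain ⟨x, -, φ, hφ, hx⟩ := hK.isSeqCompact hy
  obtain ⟨U, hU⟩ := (𝓝 (0 : E)).exists_antitone_basis
  have h1 (n : ℕ) : ∀ᶠ k in atTop, (fastWeight n)⁻¹ • (y (φ k) - x) ∈ U n := by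
    have h : Tendsto (fun k => (fastWeight n)⁻¹ • (y (φ k) - x)) atTop (𝓝 0) := by
      simpa using (hx.sub_const x).const_smul (fastWeight n)⁻¹
    exact h (hU.1.mem_of_mem trivial)
  obtain ⟨χ, hχ, hχU⟩ := extraction_forall_of_eventually h1
  exact ⟨x, φ ∘ χ, hφ.comp hχ, (hU.tendsto hχU).isVonNBounded_range ℝ⟩

/-- A family of maps which is bounded along every smooth curve has bounded pure directional
derivatives. -/
theorem exists_bound_pure_derivative [T2Space E] {F : Type*} [AddCommGroup F] [Module ℝ F]
    [TopologicalSpace F] [IsTopologicalAddGroup F] [ContinuousSMul ℝ F] [T2Space F]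
    (p : Seminorm ℝ F) {B : Set (E → F)} (l : ℕ)
    (hB : ∀ f ∈ B, ∀ c : ℝ → E, IsSmoothCurve c → IsSmoothCurve (fun t => f (c t)))
    (hbd : ∀ c : ℝ → E, IsSmoothCurve c →
      ∃ C, ∀ f ∈ B, ∀ t ∈ Set.Icc (0 : ℝ) 1, p (deriv^[l] (fun t => f (c t)) t) ≤ C)
    {K W : Set E} (hK : FastSequentiallyCompact K) (hW : Bornology.IsVonNBounded ℝ W) :
    ∃ C, ∀ f ∈ B, ∀ x ∈ K, ∀ w ∈ W, p (deriv^[l] (fun t : ℝ => f (x + t • w)) 0) ≤ C := by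
  by_contra! hcon
  have ha (n : ℕ) : 0 < fastWeight n * 2 ^ n := by have := fastWeight_pos n; positivity
  -- The violators are chosen before the subsequence `φ` is known. Summing over all `k ≤ n` makes `R
  -- (φ n)` dominate the `n`-th term, because `n ≤ φ n`.
  let R : ℕ → ℝ := fun n => ∑ k ∈ Finset.range (n + 1), k * ((fastWeight k * 2 ^ k) ^ l)⁻¹
  choose f hf y hy w hw hfw using fun n => hcon (R n)
  obtain ⟨x, φ, hφ, hbx⟩ := hK y hy
  obtain ⟨c, hc, hcn⟩ := exists_special_curve x hbx (w := fun n => w (φ n))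
    (hW.subset (Set.range_subset_iff.2 fun n => hw _))
  obtain ⟨C, hC⟩ := hbd c hc
  obtain ⟨n, hn⟩ := exists_nat_gt C
  -- Near `2 ^ (-n)` the curve is a line through `y (φ n)` with speed `fastWeight n * 2 ^ n`, so the
  -- `l`-th derivative is the pure one times the `l`-th power of that speed.
  have hev : (fun t => f (φ n) (c t)) =ᶠ[𝓝 ((2 : ℝ) ^ n)⁻¹] fun t =>
      f (φ n) (y (φ n) + (fastWeight n * 2 ^ n * t + -fastWeight n) • w (φ n)) := by
    filter_upwards [hcn n] with t ht
    rw [ht, smul_inv_smul₀ (fastWeight_pos n).ne']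
    congr 2
    abel
  have h1 := (IsSmoothCurve.eventuallyEq_iterate_deriv (hB _ (hf _) _ hc) (hB _ (hf _) _
    ((isSmoothCurve_line (y (φ n)) (w (φ n))).comp_affine (ha n).ne' _)) hev l).eq_of_nhds
  rw [(hB _ (hf _) _ (isSmoothCurve_line (y (φ n)) (w (φ n)))).iterate_deriv_comp_affine
    (ha n).ne'] at h1
  have h0 : fastWeight n * 2 ^ n * ((2 : ℝ) ^ n)⁻¹ + -fastWeight n = 0 := by
    rw [mul_assoc, mul_inv_cancel₀ (by positivity)]; ring
  simp only [h0] at h1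
  have h2 := hC _ (hf (φ n)) ((2 : ℝ) ^ n)⁻¹
    ⟨by positivity, inv_le_one_of_one_le₀ (one_le_pow₀ (by norm_num))⟩
  rw [h1, map_smul_eq_mul, norm_pow, Real.norm_eq_abs, abs_of_pos (ha n)] at h2
  have h3 : n * ((fastWeight n * 2 ^ n) ^ l)⁻¹ ≤ R (φ n) :=
    Finset.single_le_sum (f := fun k : ℕ => k * ((fastWeight k * 2 ^ k) ^ l)⁻¹)
      (fun k _ => by have := ha k; positivity)
      (Finset.mem_range.2 (Nat.lt_succ_of_le (hφ.id_le n)))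
  have h4 := h3.trans (hfw (φ n)).le
  rw [← div_eq_mul_inv, div_le_iff₀ (pow_pos (ha n) l), mul_comm] at h4
  linarith

end LocallyConvex
/-! ### Symmetry and polarization of iterated Fréchet derivatives -/

/-- Expanding by multilinearity gives a sum over index maps `r` whose image avoids `T`. The
alternating sum over such `T` vanishes unless `r` is surjective, and the `l!` permutations all
contribute `M v`. -/
theorem polarization {V G : Type*} [AddCommGroup V] [Module ℝ V] [AddCommGroup G] [Module ℝ G]
    {l : ℕ} (M : MultilinearMap ℝ (fun _ : Fin l => V) G)
    (hM : ∀ (σ : Equiv.Perm (Fin l)) (v : Fin l → V), M (v ∘ σ) = M v) (v : Fin l → V) :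
    (l.factorial : ℝ) • M v =
      ∑ T : Finset (Fin l), (-1 : ℝ) ^ T.card • M (fun _ => ∑ i ∈ Tᶜ, v i) := by
  classical
  have h1 (T : Finset (Fin l)) : M (fun _ => ∑ i ∈ Tᶜ, v i) =
      ∑ r : Fin l → Fin l, if T ⊆ (Finset.univ.image r)ᶜ then M (v ∘ r) else 0 := by
    rw [M.map_sum_finset (fun _ i => v i) (fun _ => Tᶜ), ← Finset.sum_filter]
    refine Finset.sum_congr ?_ fun _ _ => rfl
    ext r
    simp only [Fintype.mem_piFinset, Finset.mem_compl, Finset.mem_filter, Finset.mem_univ, true_and,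
      Finset.subset_iff, Finset.mem_image, not_exists]
    exact ⟨fun h i hi j hj => h j (hj ▸ hi), fun h i hi => h hi i rfl⟩
  have h2 (r : Fin l → Fin l) : (∑ T : Finset (Fin l), (-1 : ℝ) ^ T.card •
      if T ⊆ (Finset.univ.image r)ᶜ then M (v ∘ r) else 0) =
      if Function.Surjective r then M v else 0 := by
    have h3 : ∑ T ∈ (Finset.univ.image r)ᶜ.powerset, (-1 : ℝ) ^ T.card =
        if (Finset.univ.image r)ᶜ = ∅ then 1 else 0 := by
      exact_mod_cast Finset.sum_powerset_neg_one_pow_card (x := (Finset.univ.image r)ᶜ)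
    have h4 : (Finset.univ.image r)ᶜ = ∅ ↔ Function.Surjective r := by
      rw [Finset.compl_eq_empty_iff, Finset.eq_univ_iff_forall]
      simp [Function.Surjective]
    simp only [smul_ite, smul_zero]
    rw [← Finset.sum_filter, ← Finset.sum_smul]
    have h5 : (Finset.univ.filter fun T : Finset (Fin l) => T ⊆ (Finset.univ.image r)ᶜ) =
        (Finset.univ.image r)ᶜ.powerset := by ext; simp
    rw [h5, h3]
    by_cases hr : Function.Surjective r
    · rw [if_pos (h4.2 hr), if_pos hr, one_smul]
      exact hM (Equiv.ofBijective r (Finite.surjective_iff_bijective.1 hr)) v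
    · rw [if_neg (h4.not.2 hr), if_neg hr, zero_smul]
  simp only [h1, Finset.smul_sum]
  rw [Finset.sum_comm]
  simp only [h2]
  rw [← Finset.sum_filter, Finset.sum_const]
  have h6 : (Finset.univ.filter fun r : Fin l → Fin l => Function.Surjective r) =
      Finset.univ.map ⟨fun σ : Equiv.Perm (Fin l) => (σ : Fin l → Fin l),
        DFunLike.coe_injective⟩ := by
    ext r
    simp only [Finset.mem_filter, Finset.mem_univ, true_and, Finset.mem_map,
      Function.Embedding.coeFn_mk]
    exact ⟨fun h => ⟨Equiv.ofBijective r (Finite.surjective_iff_bijective.1 h), rfl⟩,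
      fun ⟨σ, h⟩ => h ▸ σ.surjective⟩
  rw [h6, Finset.card_map, Finset.card_univ, Fintype.card_perm, Fintype.card_fin,
    Nat.cast_smul_eq_nsmul]

section Smooth

variable {V G : Type*} [NormedAddCommGroup V] [NormedSpace ℝ V] [NormedAddCommGroup G]
  [NormedSpace ℝ G] {g : V → G}

theorem hasFDerivAt_iteratedFDeriv_apply (hg : ContDiff ℝ (⊤ : ℕ∞) g) {l : ℕ} (v : Fin l → V)
    (y : V) : HasFDerivAt (fun z => iteratedFDeriv ℝ l g z v)
      ((ContinuousMultilinearMap.apply ℝ (fun _ : Fin l => V) G v).comp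
        (fderiv ℝ (iteratedFDeriv ℝ l g) y)) y := by
  have h := ((hg.differentiable_iteratedFDeriv (m := l)
    (by exact_mod_cast ENat.natCast_lt_top l)) y).hasFDerivAt
  exact (ContinuousMultilinearMap.apply ℝ (fun _ : Fin l => V) G v).hasFDerivAt.comp y h

theorem fderiv_iteratedFDeriv_apply (hg : ContDiff ℝ (⊤ : ℕ∞) g) {l : ℕ} (v : Fin l → V)
    (y w : V) : fderiv ℝ (fun z => iteratedFDeriv ℝ l g z v) y w =
      iteratedFDeriv ℝ (l + 1) g y (Fin.cons w v : Fin (l + 1) → V) := by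
  rw [(hasFDerivAt_iteratedFDeriv_apply hg v y).fderiv, iteratedFDeriv_succ_apply_left]
  simp

theorem contDiff_iteratedFDeriv_apply (hg : ContDiff ℝ (⊤ : ℕ∞) g) {l : ℕ} (v : Fin l → V) :
    ContDiff ℝ (⊤ : ℕ∞) (fun z => iteratedFDeriv ℝ l g z v) :=
  (ContinuousMultilinearMap.apply ℝ (fun _ : Fin l => V) G v).contDiff.comp
    (hg.iteratedFDeriv_right (m := (⊤ : ℕ∞)) (i := l) (by exact_mod_cast le_top))

theorem hasDerivAt_iteratedFDeriv_line (hg : ContDiff ℝ (⊤ : ℕ∞) g) {l : ℕ} (v : Fin l → V)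
    (y w : V) (t : ℝ) : HasDerivAt (fun s : ℝ => iteratedFDeriv ℝ l g (y + s • w) v)
      (iteratedFDeriv ℝ (l + 1) g (y + t • w) (Fin.cons w v : Fin (l + 1) → V)) t := by
  have h1 : HasDerivAt (fun s : ℝ => y + s • w) w t := by
    simpa using ((hasDerivAt_id t).smul_const w).const_add y
  have h := ((hasFDerivAt_iteratedFDeriv_apply hg v (y + t • w)).differentiableAt.hasFDerivAt).comp_hasDerivAt
    t h1
  rwa [fderiv_iteratedFDeriv_apply hg] at h

/-- Exchanging the first two arguments is the symmetry of the second derivative of a partially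
evaluated iterated derivative. For later positions, peel off the first argument: it differentiates a
function already known to be symmetric. -/
theorem iteratedFDeriv_swap_adjacent (hg : ContDiff ℝ (⊤ : ℕ∞) g) (l : ℕ) (i : Fin l) (y : V)
    (v : Fin (l + 1) → V) :
    iteratedFDeriv ℝ (l + 1) g y (v ∘ Equiv.swap i.castSucc i.succ) =
      iteratedFDeriv ℝ (l + 1) g y v := by
  induction l generalizing y with
  | zero => exact i.elim0
  | succ l ih =>
    refine Fin.cases ?_ (fun j => ?_) i
    · obtain ⟨a, v, rfl⟩ : ∃ a u, v = Fin.cons a u := ⟨v 0, Fin.tail v, (Fin.cons_self_tail v).symm⟩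
      obtain ⟨b, v, rfl⟩ : ∃ a u, v = Fin.cons a u := ⟨v 0, Fin.tail v, (Fin.cons_self_tail v).symm⟩
      have hsw : (Fin.cons a (Fin.cons b v : Fin (l + 1) → V) : Fin (l + 2) → V) ∘
          Equiv.swap (Fin.castSucc 0) (Fin.succ 0) = Fin.cons b (Fin.cons a v : Fin (l + 1) → V) := by
        funext k
        refine Fin.cases ?_ (fun k => Fin.cases ?_ (fun k => ?_) k) k
        · simp
        · simp
        · rw [Function.comp_apply, Equiv.swap_apply_of_ne_of_ne] <;> simp [Fin.ext_iff]
      rw [hsw]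
      set h := fun z => iteratedFDeriv ℝ l g z v with hh
      have hc : ContDiff ℝ (⊤ : ℕ∞) h := contDiff_iteratedFDeriv_apply hg v
      have hsymm : IsSymmSndFDerivAt ℝ h y := 
        (contDiff_infty.1 hc 2).contDiffAt.isSymmSndFDerivAt (by simp)
      have key (a b : V) : iteratedFDeriv ℝ (l + 2) g y
          (Fin.cons a (Fin.cons b v : Fin (l + 1) → V) : Fin (l + 2) → V) =
          fderiv ℝ (fderiv ℝ h) y a b := by
        rw [← fderiv_iteratedFDeriv_apply hg]
        have : (fun z => iteratedFDeriv ℝ (l + 1) g z (Fin.cons b v : Fin (l + 1) → V)) =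
            fun z => fderiv ℝ h z b := by
          funext z
          rw [fderiv_iteratedFDeriv_apply hg]
        rw [this]
        have hd : DifferentiableAt ℝ (fderiv ℝ h) y :=
          ((hc.fderiv_right (m := (⊤ : ℕ∞)) (by exact_mod_cast le_top)).differentiable (by simp)) y
        rw [fderiv_clm_apply hd (differentiableAt_const b)]
        simp
      rw [key, key, hsymm.eq]
    · obtain ⟨a, v, rfl⟩ : ∃ a u, v = Fin.cons a u := ⟨v 0, Fin.tail v, (Fin.cons_self_tail v).symm⟩
      have hsw : (Fin.cons a v : Fin (l + 2) → V) ∘ Equiv.swap (j.succ.castSucc) (j.succ.succ) =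
          Fin.cons a (v ∘ Equiv.swap j.castSucc j.succ) := by
        funext k
        refine Fin.cases ?_ (fun k => ?_) k
        · rw [Function.comp_apply, Equiv.swap_apply_of_ne_of_ne] <;> simp [Fin.ext_iff]
        · rw [Function.comp_apply, ← Fin.succ_castSucc,
            (Fin.succ_injective (l + 1)).swap_apply, Fin.cons_succ, Fin.cons_succ,
            Function.comp_apply]
      rw [hsw, ← fderiv_iteratedFDeriv_apply hg, ← fderiv_iteratedFDeriv_apply hg]
      simp only [ih j]

theorem iteratedFDeriv_perm (hg : ContDiff ℝ (⊤ : ℕ∞) g) (l : ℕ) (y : V)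
    (σ : Equiv.Perm (Fin l)) (v : Fin l → V) :
    iteratedFDeriv ℝ l g y (v ∘ σ) = iteratedFDeriv ℝ l g y v := by
  cases l with
  | zero => rw [Subsingleton.elim (v ∘ σ) v]
  | succ l =>
    have hσ : σ ∈ Submonoid.closure
        (Set.range fun i : Fin l => Equiv.swap i.castSucc i.succ) := by
      rw [Equiv.Perm.mclosure_swap_castSucc_succ]; trivial
    induction hσ using Submonoid.closure_induction generalizing v with
    | mem τ hτ =>
      obtain ⟨i, rfl⟩ := hτ
      exact iteratedFDeriv_swap_adjacent hg l i y v
    | one => rfl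
    | mul τ₁ τ₂ _ _ h1 h2 =>
      rw [Equiv.Perm.coe_mul, ← Function.comp_assoc, h2, h1]

end Smooth

/-! ### Pure directional derivatives -/

/-- The `l`-fold derivative of `f` at `x` in the direction `w`. -/
noncomputable def pureDerivative {E F : Type*} [AddCommGroup E] [Module ℝ E] [AddCommGroup F]
    [Module ℝ F] [TopologicalSpace F] [IsTopologicalAddGroup F] [ContinuousSMul ℝ F] (l : ℕ)
    (f : E → F) (x w : E) : F :=
  deriv^[l] (fun t : ℝ => f (x + t • w)) 0

/-- The polarization of the pure derivatives of order `l`. -/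
noncomputable def polarizedDerivative {E F : Type*} [AddCommGroup E] [Module ℝ E] [AddCommGroup F]
    [Module ℝ F] [TopologicalSpace F] [IsTopologicalAddGroup F] [ContinuousSMul ℝ F] (l : ℕ)
    (f : E → F) (x : E) (w : Fin l → E) : F :=
  (l.factorial : ℝ)⁻¹ • ∑ T : Finset (Fin l), (-1 : ℝ) ^ T.card •
    pureDerivative l f x (∑ i ∈ Tᶜ, w i)

section Smooth

variable {V G : Type*} [NormedAddCommGroup V] [NormedSpace ℝ V] [NormedAddCommGroup G]
  [NormedSpace ℝ G] {g : V → G}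

theorem iteratedFDeriv_eq_pureDerivative (hg : ContDiff ℝ (⊤ : ℕ∞) g) (l : ℕ) (y w : V) :
    iteratedFDeriv ℝ l g y (fun _ => w) = pureDerivative l g y w := by
  have := iterate_deriv_eq_of_hasDerivAt
    (c := fun l t => iteratedFDeriv ℝ l g (y + t • w) (fun _ => w)) (fun n t => by
      convert hasDerivAt_iteratedFDeriv_line hg (fun _ => w) y w t using 2
      funext k
      refine Fin.cases rfl (fun _ => rfl) k) l
  have := congrFun this 0
  simp only [iteratedFDeriv_zero_apply, zero_smul, add_zero] at this
  exact this.symm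

theorem iteratedFDeriv_eq_polarizedDerivative (hg : ContDiff ℝ (⊤ : ℕ∞) g) (l : ℕ) (y : V)
    (v : Fin l → V) : iteratedFDeriv ℝ l g y v = polarizedDerivative l g y v := by
  have h := polarization (iteratedFDeriv ℝ l g y).toMultilinearMap (iteratedFDeriv_perm hg l y) v
  rw [polarizedDerivative, eq_inv_smul_iff₀ (by positivity)]
  simp only [← iteratedFDeriv_eq_pureDerivative hg]
  exact h

end Smooth

section Pure

variable {E F : Type*} [AddCommGroup E] [Module ℝ E] [AddCommGroup F]
  [Module ℝ F] [TopologicalSpace F] [IsTopologicalAddGroup F] [ContinuousSMul ℝ F] [T2Space F]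
  {f : E → F}

omit [T2Space F] in
theorem pureDerivative_zero (f : E → F) (x w : E) : pureDerivative 0 f x w = f x := by
  simp [pureDerivative]

omit [T2Space F] in
theorem polarizedDerivative_zero (f : E → F) (x : E) (w : Fin 0 → E) :
    polarizedDerivative 0 f x w = f x := by
  simp [polarizedDerivative, pureDerivative_zero, Finset.eq_empty_of_isEmpty]

theorem pureDerivative_line (hf : ∀ x w : E, IsSmoothCurve fun t : ℝ => f (x + t • w)) (l : ℕ)
    (x w : E) (t : ℝ) :
    pureDerivative l f (x + t • w) w = deriv^[l] (fun s : ℝ => f (x + s • w)) t := by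
  have h := congrFun ((hf x w).iterate_deriv_comp_affine (a := 1) one_ne_zero t l) 0
  simp only [one_mul, one_pow, one_smul, zero_add] at h
  have h1 : (fun s : ℝ => f (x + t • w + s • w)) = fun s => f (x + (s + t) • w) := by
    funext s
    rw [add_smul, add_comm (s • w), add_assoc]
  rw [← h, pureDerivative, h1]

theorem hasDerivAt_pureDerivative (hf : ∀ x w : E, IsSmoothCurve fun t : ℝ => f (x + t • w))
    (l : ℕ) (x w : E) (t : ℝ) : HasDerivAt (fun t : ℝ => pureDerivative l f (x + t • w) w)
      (pureDerivative (l + 1) f (x + t • w) w) t := by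
  simp only [pureDerivative_line hf]
  exact (hf x w).hasDerivAt l t

theorem hasDerivAt_line (hf : ∀ x w : E, IsSmoothCurve fun t : ℝ => f (x + t • w))
    (x w : E) (t : ℝ) : HasDerivAt (fun t : ℝ => f (x + t • w))
      (pureDerivative 1 f (x + t • w) w) t := by
  simpa only [pureDerivative_zero] using hasDerivAt_pureDerivative hf 0 x w t

end Pure

/-! ### Mollification -/

section Mollify

open MeasureTheory ContinuousLinearMap
open scoped Convolution

variable {V : Type*} [NormedAddCommGroup V] [NormedSpace ℝ V] [FiniteDimensional ℝ V]
  [MeasurableSpace V] [BorelSpace V]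

/-- The mollification of `h` by the bump function `φ`. -/
noncomputable def mollify (φ : ContDiffBump (0 : V)) (h : V → ℝ) : V → ℝ :=
  φ.normed Measure.addHaar ⋆[lsmul ℝ ℝ, Measure.addHaar] h

theorem mollify_apply (φ : ContDiffBump (0 : V)) (h : V → ℝ) (y : V) :
    mollify φ h y = ∫ u, φ.normed Measure.addHaar u * h (y - u) ∂Measure.addHaar := rfl

theorem contDiff_mollify (φ : ContDiffBump (0 : V)) {h : V → ℝ} (hh : Continuous h) :
    ContDiff ℝ (⊤ : ℕ∞) (mollify φ h) :=
  φ.hasCompactSupport_normed.contDiff_convolution_left _ φ.contDiff_normed hh.locallyIntegrable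

theorem integrable_mollify (φ : ContDiffBump (0 : V)) {h : V → ℝ} (hh : Continuous h) (y : V) :
    Integrable (fun u => φ.normed Measure.addHaar u * h (y - u)) Measure.addHaar :=
  (φ.continuous_normed.mul (by fun_prop)).integrable_of_hasCompactSupport
    φ.hasCompactSupport_normed.mul_right

theorem mollify_sum (φ : ContDiffBump (0 : V)) {ι : Type*} (s : Finset ι) (a : ι → ℝ)
    {h : ι → V → ℝ} (hh : ∀ i, Continuous (h i)) (y : V) :
    mollify φ (fun y => ∑ i ∈ s, a i * h i y) y = ∑ i ∈ s, a i * mollify φ (h i) y := by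
  simp only [mollify_apply, ← integral_const_mul]
  rw [← integral_finsetSum _ fun i _ => (integrable_mollify φ (hh i) y).const_mul (a i)]
  congr 1
  funext u
  rw [Finset.mul_sum]
  refine Finset.sum_congr rfl fun i _ => by ring

/-- Differentiation under the integral sign, dominated by the kernel times the maximum of `h'` over
a compact set. -/
theorem hasDerivAt_mollify (φ : ContDiffBump (0 : V)) {h h' : V → ℝ} (hh : Continuous h)
    (hh' : Continuous h') {w : V}
    (hd : ∀ (y : V) (t : ℝ), HasDerivAt (fun s : ℝ => h (y + s • w)) (h' (y + t • w)) t) (y : V)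
    (t : ℝ) : HasDerivAt (fun s : ℝ => mollify φ h (y + s • w)) (mollify φ h' (y + t • w)) t := by
  simp only [mollify_apply]
  obtain ⟨C, hC⟩ := ((isCompact_closedBall t 1).prod
    (isCompact_closedBall (0 : V) φ.rOut)).exists_bound_of_continuousOn
    (f := fun p : ℝ × V => h' (y + p.1 • w - p.2)) (by fun_prop)
  have h1 : ∀ᵐ u ∂(Measure.addHaar : Measure V), ∀ s ∈ Metric.closedBall t 1,
      ‖φ.normed Measure.addHaar u * h' (y + s • w - u)‖ ≤ φ.normed Measure.addHaar u * C := by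
    refine .of_forall fun u s hs => ?_
    rw [norm_mul, Real.norm_of_nonneg (φ.nonneg_normed u)]
    by_cases hu : u ∈ Metric.closedBall (0 : V) φ.rOut
    · exact mul_le_mul_of_nonneg_left (hC (s, u) ⟨hs, hu⟩) (φ.nonneg_normed u)
    · have : φ.normed Measure.addHaar u = 0 := by
        refine image_eq_zero_of_notMem_tsupport ?_
        rwa [φ.tsupport_normed_eq]
      simp [this]
  have h2 : ∀ᵐ u ∂(Measure.addHaar : Measure V), ∀ s ∈ Metric.closedBall t 1,
      HasDerivAt (fun s : ℝ => φ.normed Measure.addHaar u * h (y + s • w - u))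
        (φ.normed Measure.addHaar u * h' (y + s • w - u)) s := by
    refine .of_forall fun u s _ => ?_
    have := (hd (y - u) s).const_mul (φ.normed Measure.addHaar u)
    simp only [sub_add_eq_add_sub] at this
    exact this
  have h3 : Integrable (fun u => φ.normed Measure.addHaar u * C) (Measure.addHaar : Measure V) :=
    (φ.continuous_normed.integrable_of_hasCompactSupport φ.hasCompactSupport_normed).mul_const C
  exact (hasDerivAt_integral_of_dominated_loc_of_deriv_le (μ := (Measure.addHaar : Measure V))
    (F := fun s u => φ.normed Measure.addHaar u * h (y + s • w - u))
    (F' := fun s u => φ.normed Measure.addHaar u * h' (y + s • w - u))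
    (Metric.closedBall_mem_nhds t one_pos)
    (.of_forall fun s => (integrable_mollify φ hh _).aestronglyMeasurable)
    (integrable_mollify φ hh _) (integrable_mollify φ hh' _).aestronglyMeasurable h1 h3 h2).2

theorem tendstoUniformlyOnFilter_iff_sub {ι α G : Type*} [AddCommGroup G] [UniformSpace G]
    [IsUniformAddGroup G] {F : ι → α → G} {f : α → G} {p : Filter ι} {p' : Filter α} :
    TendstoUniformlyOnFilter F f p p' ↔
      Tendsto (fun q : ι × α => F q.1 q.2 - f q.2) (p ×ˢ p') (𝓝 0) := by
  rw [tendstoUniformlyOnFilter_iff_tendsto, uniformity_eq_comap_nhds_zero, tendsto_comap_iff]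
  rfl

theorem tendsto_mollify {φ : ℕ → ContDiffBump (0 : V)}
    (hφ : Tendsto (fun n => (φ n).rOut) atTop (𝓝 0)) {h : V → ℝ} (hh : Continuous h) (y : V) :
    TendstoUniformlyOnFilter (fun n => mollify (φ n) h) h atTop (𝓝 y) := by
  rw [Metric.tendstoUniformlyOnFilter_iff]
  intro ε hε
  obtain ⟨δ, hδ, hball⟩ := Metric.continuousAt_iff.1 hh.continuousAt (ε / 4) (by positivity)
  refine ((hφ.eventually (gt_mem_nhds (half_pos hδ))).prod_mk
    (Metric.ball_mem_nhds y (half_pos hδ))).mono fun p ⟨h1, h2⟩ => ?_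
  have h3 : dist (mollify (φ p.1) h p.2) (h p.2) ≤ ε / 2 := by
    refine (φ p.1).dist_normed_convolution_le hh.aestronglyMeasurable fun x hx => ?_
    have h4 : dist x y < δ := by
      have := dist_triangle x p.2 y
      have := Metric.mem_ball.1 hx
      have := Metric.mem_ball.1 h2
      linarith
    have h5 : dist p.2 y < δ := by
      have := Metric.mem_ball.1 h2
      linarith
    have := dist_triangle_right (h x) (h p.2) (h y)
    have := hball h4
    have := hball h5
    linarith
  rw [dist_comm]
  linarith

end Mollify

/-! ### Boman's theorem -/

section Boman

variable {V : Type*} [NormedAddCommGroup V] [NormedSpace ℝ V] [FiniteDimensional ℝ V]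
  {g : V → ℝ}

/-- If the mollifications of `h` have the mollifications of `h'` as directional derivatives, then
`h` is differentiable with directional derivatives `h'`. -/
theorem hasFDerivAt_of_mollify [MeasurableSpace V] [BorelSpace V] {h : V → ℝ} {h' : V → V → ℝ}
    (hh : Continuous h) (hh' : ∀ w, Continuous (h' w))
    (hd : ∀ (φ : ContDiffBump (0 : V)) (y w : V),
      fderiv ℝ (mollify φ h) y w = mollify φ (h' w) y) (y : V) :
    HasFDerivAt h (∑ i, h' (Module.finBasis ℝ V i) y •
      ((Module.finBasis ℝ V).coord i).toContinuousLinearMap) y := by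
  let φ : ℕ → ContDiffBump (0 : V) := fun n =>
    ⟨1 / (2 * ((n : ℝ) + 1)), 1 / ((n : ℝ) + 1), by positivity,
      one_div_lt_one_div_of_lt (by positivity) (by linarith [Nat.cast_nonneg (α := ℝ) n])⟩
  have hφ : Tendsto (fun n => (φ n).rOut) atTop (𝓝 0) := tendsto_one_div_add_atTop_nhds_zero_nat
  -- The derivatives are controlled only one direction at a time; basis coordinates turn this into
  -- locally uniform convergence of the linear maps.
  refine hasFDerivAt_of_tendstoUniformlyOnFilter (l := atTop) (f := fun n => mollify (φ n) h)
    (f' := fun n y => ∑ i, mollify (φ n) (h' (Module.finBasis ℝ V i)) y •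
      ((Module.finBasis ℝ V).coord i).toContinuousLinearMap)
    (g' := fun y => ∑ i, h' (Module.finBasis ℝ V i) y •
      ((Module.finBasis ℝ V).coord i).toContinuousLinearMap) ?_ ?_ ?_
  · have := fun i => tendsto_mollify hφ (hh' (Module.finBasis ℝ V i)) y
    simp only [tendstoUniformlyOnFilter_iff_sub, ← Finset.sum_sub_distrib, ← sub_smul] at this ⊢
    have h := tendsto_finsetSum Finset.univ fun i _ => (this i).smul_const
      ((Module.finBasis ℝ V).coord i).toContinuousLinearMap
    simpa using h
  · refine .of_forall fun p => ?_
    have := ((contDiff_mollify (φ p.1) hh).differentiable (by simp) p.2).hasFDerivAt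
    convert this using 1
    refine ContinuousLinearMap.coe_injective ((Module.finBasis ℝ V).ext fun j => ?_)
    simp [hd, Finsupp.single_apply]
  · exact .of_forall fun z => (tendsto_mollify hφ hh z).tendsto_at
      (principal_singleton z ▸ pure_le_nhds z)

end Boman

section Boman

variable {V : Type*} [NormedAddCommGroup V] [NormedSpace ℝ V] [FiniteDimensional ℝ V]
  {g : V → ℝ}

/-- The special curve argument for the family `{g}`, whose bounds along a single curve come from
continuity. In the proof of Boman's theorem this alone uses curves other than lines. -/
theorem exists_bound_pureDerivative_ball
    (hg : ∀ c : ℝ → V, IsSmoothCurve c → IsSmoothCurve fun t => g (c t)) (l : ℕ) (y : V) (R : ℝ) :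
    ∃ C, ∀ x ∈ Metric.closedBall y R, ∀ w ∈ Metric.closedBall (0 : V) R,
      |pureDerivative l g x w| ≤ C := by
  obtain ⟨C, hC⟩ := exists_bound_pure_derivative (normSeminorm ℝ ℝ) (B := {g}) l
    (by rintro _ rfl; exact hg) (fun c hc => by
      obtain ⟨C, hC⟩ := (isCompact_Icc (a := (0 : ℝ)) (b := 1)).exists_bound_of_continuousOn
        ((hg c hc).continuous_iterate_deriv l).continuousOn
      exact ⟨C, by rintro _ rfl; exact hC⟩)
    (IsCompact.fastSequentiallyCompact (isCompact_closedBall y R))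
    ((NormedSpace.isVonNBounded_iff ℝ).2 (Metric.isBounded_closedBall (x := (0 : V)) (r := R)))
  exact ⟨C, hC g rfl⟩

/-- Bounded first directional derivatives near `y` give a Lipschitz estimate at `y` along segments.
-/
theorem continuous_of_comp_smoothCurve
    (hg : ∀ c : ℝ → V, IsSmoothCurve c → IsSmoothCurve fun t => g (c t)) : Continuous g := by
  have hl : ∀ x w : V, IsSmoothCurve fun t : ℝ => g (x + t • w) :=
    fun x w => hg _ (isSmoothCurve_line x w)
  refine continuous_iff_continuousAt.2 fun y => ?_
  obtain ⟨C, hC⟩ := exists_bound_pureDerivative_ball hg 1 y 1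
  have hC0 : 0 ≤ C := (abs_nonneg _).trans (hC y (by simp) 0 (by simp))
  have key : ∀ x ∈ Metric.closedBall y 1, ‖g x - g y‖ ≤ C * ‖x - y‖ := fun x hx => by
    rcases eq_or_ne x y with rfl | hne
    · simp
    have hpos : 0 < ‖x - y‖ := norm_pos_iff.2 (sub_ne_zero.2 hne)
    have hle : ‖x - y‖ ≤ 1 := by simpa [dist_eq_norm] using hx
    have h := (convex_Icc (0 : ℝ) ‖x - y‖).norm_image_sub_le_of_norm_hasDerivWithin_le
      (f := fun t : ℝ => g (y + t • (‖x - y‖⁻¹ • (x - y)))) (C := C) (fun t _ =>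
      (hasDerivAt_line hl y (‖x - y‖⁻¹ • (x - y)) t).hasDerivWithinAt) (fun t ht =>
      hC _ ?_ _ ?_) (Set.left_mem_Icc.2 hpos.le) (Set.right_mem_Icc.2 hpos.le)
    · simpa [smul_smul, hpos.ne'] using h
    · have h1 : ‖t • (‖x - y‖⁻¹ • (x - y))‖ = t := by
        rw [norm_smul, norm_smul, norm_inv, norm_norm, inv_mul_cancel₀ hpos.ne', mul_one,
          Real.norm_of_nonneg ht.1]
      simp only [Metric.mem_closedBall, dist_eq_norm, add_sub_cancel_left, h1]
      exact ht.2.trans hle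
    · simp [norm_smul, hpos.ne']
  rw [ContinuousAt, tendsto_iff_norm_sub_tendsto_zero]
  refine squeeze_zero' (.of_forall fun _ => norm_nonneg _)
    (Filter.eventually_of_mem (Metric.closedBall_mem_nhds y one_pos) key) ?_
  exact Continuous.tendsto' (by fun_prop) _ _ (by simp)

/-- By induction: the derivative of order `l + 1` is a locally uniform limit of difference quotients
of the continuous one of order `l`, with error at most `C * s` by the local bound in order `l + 2`.
-/
theorem continuous_pureDerivative
    (hg : ∀ c : ℝ → V, IsSmoothCurve c → IsSmoothCurve fun t => g (c t)) (l : ℕ) (w : V) :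
    Continuous fun y => pureDerivative l g y w := by
  have hl : ∀ x w : V, IsSmoothCurve fun t : ℝ => g (x + t • w) :=
    fun x w => hg _ (isSmoothCurve_line x w)
  induction l with
  | zero => simpa [pureDerivative] using continuous_of_comp_smoothCurve hg
  | succ l ih =>
    refine continuous_iff_continuousAt.2 fun y =>
      continuousAt_of_locally_uniform_approx_of_continuousAt fun u hu => ?_
    obtain ⟨ε, hε, hεu⟩ := Metric.mem_uniformity_dist.1 hu
    -- The radius `1 + ‖w‖` covers both the direction `w` and the points `x + t • w` with `dist x y
    -- ≤ 1` and `0 ≤ t ≤ 1`.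
    obtain ⟨C, hC⟩ := exists_bound_pureDerivative_ball hg (l + 2) y (1 + ‖w‖)
    have hC0 : 0 ≤ C := (abs_nonneg _).trans (hC y (by simp; positivity) 0 (by simp; positivity))
    obtain ⟨s, hs, hs1, hsε⟩ : ∃ s : ℝ, 0 < s ∧ s ≤ 1 ∧ C * s < ε := by
      refine ⟨min 1 (ε / (C + 1)), by positivity, min_le_left _ _, ?_⟩
      calc C * min 1 (ε / (C + 1)) ≤ C * (ε / (C + 1)) := by gcongr; exact min_le_right _ _
        _ < ε := by
          rw [mul_div_assoc', div_lt_iff₀ (by positivity)]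
          nlinarith
    refine ⟨Metric.closedBall y 1, Metric.closedBall_mem_nhds y one_pos,
      fun x => s⁻¹ * (pureDerivative l g (x + s • w) w - pureDerivative l g x w), ?_,
      fun x hx => hεu ?_⟩
    · have : Continuous fun x => pureDerivative l g (x + s • w) w :=
        ih.comp (continuous_id.add continuous_const)
      exact (continuous_const.mul (this.sub ih)).continuousAt
    · have h := abs_sub_sub_le_of_second_deriv (hasDerivAt_pureDerivative hl l x w)
        (hasDerivAt_pureDerivative hl (l + 1) x w) (C := C) (s := s) (t := 0) fun t ht => by
          refine hC _ ?_ _ (by simp)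
          rw [Set.uIcc_of_le hs.le] at ht
          rw [Metric.mem_closedBall]
          calc dist (x + t • w) y ≤ dist (x + t • w) x + dist x y := dist_triangle _ _ _
            _ ≤ ‖w‖ + 1 := by
              refine add_le_add ?_ hx
              rw [dist_eq_norm, add_sub_cancel_left, norm_smul, Real.norm_of_nonneg ht.1]
              exact mul_le_of_le_one_left (norm_nonneg _) (ht.2.trans hs1)
            _ = _ := add_comm _ _
      simp only [zero_smul, add_zero, sub_zero, abs_of_pos hs] at h
      rw [Real.dist_eq, abs_sub_comm]
      calc _ = |s⁻¹ * (pureDerivative l g (x + s • w) w - pureDerivative l g x w -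
            s * pureDerivative (l + 1) g x w)| := by
            congr 1
            field_simp
        _ = s⁻¹ * |(pureDerivative l g (x + s • w) w - pureDerivative l g x w -
            s * pureDerivative (l + 1) g x w)| := by rw [abs_mul, abs_of_pos (inv_pos.2 hs)]
        _ ≤ s⁻¹ * (C * s ^ 2) := by gcongr
        _ = C * s := by field_simp
        _ < ε := hsε

theorem continuous_polarizedDerivative
    (hg : ∀ c : ℝ → V, IsSmoothCurve c → IsSmoothCurve fun t => g (c t)) (l : ℕ) (v : Fin l → V) :
    Continuous fun y => polarizedDerivative l g y v := by
  simp only [polarizedDerivative]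
  exact continuous_const.mul (continuous_finsetSum _ fun T _ =>
    continuous_const.mul (continuous_pureDerivative hg l (∑ i ∈ Tᶜ, v i)))

theorem pureDerivative_mollify [MeasurableSpace V] [BorelSpace V]
    (hg : ∀ c : ℝ → V, IsSmoothCurve c → IsSmoothCurve fun t => g (c t))
    (φ : ContDiffBump (0 : V)) (l : ℕ) (y w : V) :
    pureDerivative l (mollify φ g) y w = mollify φ (fun y => pureDerivative l g y w) y := by
  have hl : ∀ x w : V, IsSmoothCurve fun t : ℝ => g (x + t • w) :=
    fun x w => hg _ (isSmoothCurve_line x w)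
  have h := congrFun (iterate_deriv_eq_of_hasDerivAt
    (c := fun l (t : ℝ) => mollify φ (fun y => pureDerivative l g y w) (y + t • w)) (fun n t =>
      hasDerivAt_mollify φ (continuous_pureDerivative hg n w) (continuous_pureDerivative hg _ w)
        (fun y t => hasDerivAt_pureDerivative hl n y w t) y t) l) 0
  simpa [pureDerivative] using h

theorem polarizedDerivative_mollify [MeasurableSpace V] [BorelSpace V]
    (hg : ∀ c : ℝ → V, IsSmoothCurve c → IsSmoothCurve fun t => g (c t))
    (φ : ContDiffBump (0 : V)) (l : ℕ) (y : V) (v : Fin l → V) :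
    polarizedDerivative l (mollify φ g) y v =
      mollify φ (fun y => polarizedDerivative l g y v) y := by
  simp only [polarizedDerivative, smul_eq_mul, Finset.mul_sum, ← mul_assoc]
  rw [mollify_sum φ _ _ fun T => continuous_pureDerivative hg l _]
  simp only [pureDerivative_mollify hg]

/-- For the smooth mollifications, polarized derivatives are genuine iterated Fréchet derivatives,
so differentiating raises the order by one. Polarized derivatives commute with mollification, and
the relation survives in the limit. -/
theorem hasFDerivAt_polarizedDerivative
    (hg : ∀ c : ℝ → V, IsSmoothCurve c → IsSmoothCurve fun t => g (c t)) (l : ℕ) (v : Fin l → V)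
    (y : V) : HasFDerivAt (fun y => polarizedDerivative l g y v)
      (∑ i, polarizedDerivative (l + 1) g y (Fin.cons (Module.finBasis ℝ V i) v : Fin (l + 1) → V) •
        ((Module.finBasis ℝ V).coord i).toContinuousLinearMap) y := by
  borelize V
  refine hasFDerivAt_of_mollify
    (h' := fun w y => polarizedDerivative (l + 1) g y (Fin.cons w v : Fin (l + 1) → V))
    (continuous_polarizedDerivative hg l v)
    (fun w => continuous_polarizedDerivative hg _ _) (fun φ y w => ?_) y
  have hs := contDiff_mollify φ (continuous_of_comp_smoothCurve hg)
  rw [← polarizedDerivative_mollify hg, ← iteratedFDeriv_eq_polarizedDerivative hs,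
    ← fderiv_iteratedFDeriv_apply hs]
  congr 2
  funext z
  rw [← polarizedDerivative_mollify hg, iteratedFDeriv_eq_polarizedDerivative hs]

/-- Boman's theorem: a scalar function on a finite-dimensional space which is smooth along all
smooth curves is smooth. -/
theorem contDiff_of_comp_smoothCurve
    (hg : ∀ c : ℝ → V, IsSmoothCurve c → IsSmoothCurve fun t => g (c t)) :
    ContDiff ℝ (⊤ : ℕ∞) g := by
  have key (n : ℕ) : ∀ (l : ℕ) (v : Fin l → V),
      ContDiff ℝ n fun y => polarizedDerivative l g y v := by
    induction n with
    | zero => exact fun l v => contDiff_zero.2 (continuous_polarizedDerivative hg l v)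
    | succ n ih =>
      intro l v
      refine contDiff_succ_iff_hasFDerivAt.2 ⟨_, ?_, hasFDerivAt_polarizedDerivative hg l v⟩
      exact ContDiff.sum fun i _ => (ih _ _).smul contDiff_const
  refine contDiff_infty.2 fun n => ?_
  convert key n 0 Fin.elim0 using 2 with y
  rw [polarizedDerivative_zero]

end Boman

/-! ### Iterated differentials of smooth maps -/

section Slices

variable {E : Type*} [AddCommGroup E] [Module ℝ E] [TopologicalSpace E]
  [IsTopologicalAddGroup E] [ContinuousSMul ℝ E] [T2Space E]

/-- The linear map with prescribed values on the standard basis. -/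
noncomputable def sliceMap {m : ℕ} (w : Fin m → E) : (Fin m → ℝ) →L[ℝ] E :=
  ∑ i, (ContinuousLinearMap.proj (R := ℝ) (φ := fun _ : Fin m => ℝ) i).smulRight (w i)

omit [T2Space E] in
theorem sliceMap_apply {m : ℕ} (w : Fin m → E) (s : Fin m → ℝ) :
    sliceMap w s = ∑ i, s i • w i := by
  simp [sliceMap]

omit [T2Space E] in
theorem sliceMap_single {m : ℕ} (w : Fin m → E) (i : Fin m) :
    sliceMap w (Pi.single i 1) = w i := by
  rw [sliceMap_apply, Finset.sum_eq_single i] <;> simp +contextual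

theorem contDiff_slice {g : E → ℝ}
    (hg : ∀ c : ℝ → E, IsSmoothCurve c → IsSmoothCurve fun t => g (c t)) (x : E) {m : ℕ}
    (w : Fin m → E) : ContDiff ℝ (⊤ : ℕ∞) fun s => g (x + sliceMap w s) :=
  contDiff_of_comp_smoothCurve fun _ hc =>
    hg _ ((isSmoothCurve_const x).add (hc.clm_comp (sliceMap w)))

omit [T2Space E] in
theorem pureDerivative_slice (g : E → ℝ) (x : E) {m : ℕ} (w : Fin m → E) (l : ℕ)
    (s u : Fin m → ℝ) : pureDerivative l (fun s => g (x + sliceMap w s)) s u =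
      pureDerivative l g (x + sliceMap w s) (sliceMap w u) := by
  simp only [pureDerivative, map_add, map_smul, add_assoc]

omit [T2Space E] in
theorem polarizedDerivative_slice (g : E → ℝ) (x : E) {m : ℕ} (w : Fin m → E) (l : ℕ)
    (s : Fin m → ℝ) (v : Fin l → Fin m → ℝ) :
    polarizedDerivative l (fun s => g (x + sliceMap w s)) s v =
      polarizedDerivative l g (x + sliceMap w s) (fun i => sliceMap w (v i)) := by
  simp only [polarizedDerivative, pureDerivative_slice, map_sum]

/-- The iterated Fréchet derivatives of a slice, on standard basis vectors. -/
theorem iteratedFDeriv_slice {g : E → ℝ}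
    (hg : ∀ c : ℝ → E, IsSmoothCurve c → IsSmoothCurve fun t => g (c t)) (x : E) {m : ℕ}
    (w : Fin m → E) (l : ℕ) (s : Fin m → ℝ) (r : Fin l → Fin m) :
    iteratedFDeriv ℝ l (fun s => g (x + sliceMap w s)) s (fun i => Pi.single (r i) 1) =
      polarizedDerivative l g (x + sliceMap w s) (fun i => w (r i)) := by
  rw [iteratedFDeriv_eq_polarizedDerivative (contDiff_slice hg x w), polarizedDerivative_slice]
  simp only [sliceMap_single]

/-- Only the affine span of `x` in the directions `a` and `w i` is involved; on that slice Boman's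
theorem makes `g` smooth in the Fréchet sense. -/
theorem hasDerivAt_polarizedDerivative_real {g : E → ℝ}
    (hg : ∀ c : ℝ → E, IsSmoothCurve c → IsSmoothCurve fun t => g (c t)) (l : ℕ) (x a : E)
    (w : Fin l → E) (t : ℝ) : HasDerivAt (fun t : ℝ => polarizedDerivative l g (x + t • a) w)
      (polarizedDerivative (l + 1) g (x + t • a) (Fin.cons a w : Fin (l + 1) → E)) t := by
  have h := hasDerivAt_iteratedFDeriv_line
    (contDiff_slice hg x (Fin.cons a w : Fin (l + 1) → E))
    (fun i : Fin l => Pi.single i.succ (1 : ℝ)) 0 (Pi.single 0 1) t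
  have hc : (Fin.cons (Pi.single 0 1) (fun i : Fin l => Pi.single i.succ (1 : ℝ)) :
      Fin (l + 1) → Fin (l + 1) → ℝ) = fun i => Pi.single i 1 := by
    funext i
    refine Fin.cases rfl (fun _ => rfl) i
  rw [hc] at h
  have h1 (t : ℝ) := iteratedFDeriv_slice hg x (Fin.cons a w : Fin (l + 1) → E) l
    (0 + t • Pi.single 0 1) Fin.succ
  have h2 := iteratedFDeriv_slice hg x (Fin.cons a w : Fin (l + 1) → E) (l + 1)
    (0 + t • Pi.single 0 1) id
  simp only [id] at h2
  simp only [h1, h2] at h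
  simpa only [zero_add, map_smul, sliceMap_single, Fin.cons_zero, Fin.cons_succ] using h

variable {F : Type*} [AddCommGroup F] [Module ℝ F] [TopologicalSpace F]
  [IsTopologicalAddGroup F] [ContinuousSMul ℝ F] [T2Space F]

theorem polarizedDerivative_dual {f : E → F}
    (hf : ∀ c : ℝ → E, IsSmoothCurve c → IsSmoothCurve fun t => f (c t)) (L : F →L[ℝ] ℝ) (l : ℕ)
    (x : E) (w : Fin l → E) :
    polarizedDerivative l (fun y => L (f y)) x w = L (polarizedDerivative l f x w) := by
  simp only [polarizedDerivative, pureDerivative, map_smul, map_sum]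
  congr 2
  funext T
  rw [(hf _ (isSmoothCurve_line x (∑ i ∈ Tᶜ, w i))).iterate_deriv_clm_comp L]

theorem polarizedDerivative_smul {f : E → F}
    (hf : ∀ c : ℝ → E, IsSmoothCurve c → IsSmoothCurve fun t => f (c t)) (a : ℝ) (l : ℕ)
    (x : E) (w : Fin l → E) :
    polarizedDerivative l (a • f) x w = a • polarizedDerivative l f x w := by
  have h (w : E) : pureDerivative l (a • f) x w = a • pureDerivative l f x w :=
    congrFun ((hf _ (isSmoothCurve_line x w)).iterate_deriv_smul a l) 0
  simp only [polarizedDerivative, h]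
  rw [smul_comm a, Finset.smul_sum (r := a)]
  simp only [smul_comm a]

/-- The iterated differentials of a smooth map exist and are polarizations of pure derivatives. -/
theorem iteratedDifferential_eq_polarizedDerivative [LocallyConvexSpace ℝ F] {f : E → F}
    (hf : ∀ c : ℝ → E, IsSmoothCurve c → IsSmoothCurve fun t => f (c t)) (l : ℕ) (x : E)
    (w : Fin l → E) : iteratedDifferential f l x w = polarizedDerivative l f x w := by
  induction l generalizing x with
  | zero => rw [polarizedDerivative_zero]; rfl
  | succ l ih =>
    rw [iteratedDifferential]
    simp only [ih]
    have hg (L : F →L[ℝ] ℝ) : ∀ c : ℝ → E, IsSmoothCurve c → IsSmoothCurve fun t => L (f (c t)) :=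
      fun c hc => (hf c hc).clm_comp L
    have h (l : ℕ) (a : E) (w : Fin l → E) (L : F →L[ℝ] ℝ) (t : ℝ) :=
      hasDerivAt_polarizedDerivative_real (g := fun y => L (f y)) (hg L) l x a w t
    simp only [polarizedDerivative_dual hf] at h
    -- The weak derivatives are represented by elements of `F`, namely polarized derivatives of the
    -- next orders, so weak differentiability upgrades to differentiability in `F`.
    have key := deriv_eq_of_hasDerivAt (hasDerivAt_of_dual (h l (w 0) (Fin.tail w))
      (h (l + 1) (w 0) (Fin.cons (w 0) (Fin.tail w)))
      fun L => continuous_of_hasDerivAt (h (l + 2) (w 0) _ L))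
    rw [key]
    simp

end Slices

/-! ### Bounds for mixed differentials from bounds along curves -/

section BoundedDifferentials

variable {E : Type*} [AddCommGroup E] [Module ℝ E] [TopologicalSpace E]
  [IsTopologicalAddGroup E] [ContinuousSMul ℝ E] [LocallyConvexSpace ℝ E] [T2Space E]
  {F : Type*} [AddCommGroup F] [Module ℝ F] [TopologicalSpace F]
  [IsTopologicalAddGroup F] [ContinuousSMul ℝ F] [LocallyConvexSpace ℝ F] [T2Space F]

omit [LocallyConvexSpace ℝ F] in
/-- Boundedness along curves implies boundedness of the differentials. -/
theorem exists_bound_polarizedDerivative (p : Seminorm ℝ F) {B : Set (E → F)} (l : ℕ)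
    (hB : ∀ f ∈ B, ∀ c : ℝ → E, IsSmoothCurve c → IsSmoothCurve (fun t => f (c t)))
    (hbd : ∀ c : ℝ → E, IsSmoothCurve c →
      ∃ C, ∀ f ∈ B, ∀ t ∈ Set.Icc (0 : ℝ) 1, p (deriv^[l] (fun t => f (c t)) t) ≤ C)
    {K W : Set E} (hK : FastSequentiallyCompact K) (hW : Bornology.IsVonNBounded ℝ W) :
    ∃ C, ∀ f ∈ B, ∀ x ∈ K, ∀ w : Fin l → E, (∀ i, w i ∈ W) →
      p (polarizedDerivative l f x w) ≤ C := by
  -- Polarization evaluates pure derivatives at partial sums of the `w i`, so `W` is enlarged to the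
  -- set of these sums, which is still bounded.
  have hW' : Bornology.IsVonNBounded ℝ (Set.range fun q : (Fin l → W) × Finset (Fin l) =>
      ∑ i ∈ q.2, (q.1 i : E)) := by
    refine (isVonNBounded_range_iff_seminorm _).2 fun q hq => ?_
    obtain ⟨C, hC⟩ := isVonNBounded_iff_seminorm.1 hW q hq
    refine ⟨∑ _i : Fin l, |C|, fun r => ?_⟩
    calc q (∑ i ∈ r.2, (r.1 i : E)) ≤ ∑ i ∈ r.2, q (r.1 i : E) :=
          Finset.le_sum_of_subadditive q (map_zero q).le (map_add_le_add q) _ _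
      _ ≤ ∑ i ∈ r.2, |C| := Finset.sum_le_sum fun i _ => (hC _ (r.1 i).2).trans (le_abs_self C)
      _ ≤ _ := Finset.sum_le_sum_of_subset_of_nonneg (Finset.subset_univ _)
          fun _ _ _ => abs_nonneg C
  obtain ⟨C, hC⟩ := exists_bound_pure_derivative p l hB hbd hK hW'
  refine ⟨‖(l.factorial : ℝ)⁻¹‖ * ∑ _T : Finset (Fin l), C, fun f hf x hx w hw => ?_⟩
  rw [polarizedDerivative, map_smul_eq_mul]
  gcongr
  refine (Finset.le_sum_of_subadditive p (map_zero p).le (map_add_le_add p) _ _).trans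
    (Finset.sum_le_sum fun T _ => ?_)
  rw [map_smul_eq_mul, norm_pow, norm_neg, norm_one, one_pow, one_mul]
  exact hC f hf x hx _ ⟨(fun i => ⟨w i, hw i⟩, Tᶜ), rfl⟩

end BoundedDifferentials

/-! ### Derivatives along curves in terms of differentials -/

section Taylor

theorem exists_taylor_bound {u : ℝ → ℝ} (hu : ContDiff ℝ (⊤ : ℕ∞) u) (l : ℕ) :
    ∃ C, ∀ t ∈ Set.Icc (0 : ℝ) 1,
      |u t - ∑ j ∈ Finset.range (l + 1), (((j.factorial : ℝ)⁻¹ * t ^ j) * deriv^[j] u 0)| ≤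
        C * t ^ (l + 1) := by
  obtain ⟨C, hC⟩ := exists_taylor_mean_remainder_bound (f := u) (n := l) zero_le_one
    (contDiff_infty.1 hu (l + 1)).contDiffOn
  refine ⟨C, fun t ht => ?_⟩
  have h := hC t ht
  rw [taylor_within_apply] at h
  simp only [sub_zero, smul_eq_mul] at h
  have h1 (j : ℕ) : deriv^[j] u 0 = iteratedDerivWithin j u (Set.Icc 0 1) 0 := by
    rw [iteratedDerivWithin_eq_iteratedDeriv (uniqueDiffOn_Icc zero_lt_one)
      (contDiff_infty.1 hu j).contDiffAt (Set.left_mem_Icc.2 zero_le_one), iteratedDeriv_eq_iterate]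
  simp only [h1]
  exact h

/-- Once the lower derivatives vanish, the Taylor formula leaves `t ^ k` times a constant, up to
`O(t ^ (k + 1))`. Divide by `t ^ k` and let `t` tend to `0` from the right. -/
theorem iterate_deriv_eq_zero_of_isBigO {z : ℝ → ℝ} (hz : ContDiff ℝ (⊤ : ℕ∞) z) {l : ℕ} {C : ℝ}
    (hC : ∀ t ∈ Set.Icc (0 : ℝ) 1, |z t| ≤ C * t ^ (l + 1)) (k : ℕ) (hk : k ≤ l) :
    deriv^[k] z 0 = 0 := by
  induction k using Nat.strong_induction_on with
  | _ k ih =>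
    obtain ⟨D, hD⟩ := exists_taylor_bound hz k
    have hC0 : 0 ≤ C := by simpa using (abs_nonneg _).trans (hC 1 (by simp))
    have h1 : ∀ t ∈ Set.Ioc (0 : ℝ) 1, |(k.factorial : ℝ)⁻¹ * deriv^[k] z 0| ≤ (C + D) * t := by
      intro t ht
      have ht' : t ∈ Set.Icc (0 : ℝ) 1 := ⟨ht.1.le, ht.2⟩
      have h2 := hD t ht'
      rw [Finset.sum_range_succ, Finset.sum_eq_zero fun j hj => by
        rw [ih j (Finset.mem_range.1 hj) ((Finset.mem_range.1 hj).le.trans hk), mul_zero],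
        zero_add] at h2
      have h3 : |z t| ≤ C * t ^ (k + 1) := (hC t ht').trans (by
        gcongr C * ?_
        exact pow_le_pow_of_le_one ht.1.le ht.2 (by omega))
      have h4 : |(k.factorial : ℝ)⁻¹ * t ^ k * deriv^[k] z 0| ≤ (C + D) * t ^ (k + 1) := by
        have := abs_sub_abs_le_abs_sub ((k.factorial : ℝ)⁻¹ * t ^ k * deriv^[k] z 0) (z t)
        rw [abs_sub_comm] at this
        linarith
      rw [mul_right_comm, abs_mul, abs_of_pos (pow_pos ht.1 k), pow_succ, mul_left_comm,
        mul_comm] at h4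
      exact le_of_mul_le_mul_left h4 (pow_pos ht.1 k)
    have h5 : |(k.factorial : ℝ)⁻¹ * deriv^[k] z 0| ≤ 0 := by
      refine ge_of_tendsto (f := fun t => (C + D) * t) (x := 𝓝[>] (0 : ℝ)) ?_ ?_
      · exact tendsto_nhdsWithin_of_tendsto_nhds (Continuous.tendsto' (by fun_prop) _ _ (by simp))
      · filter_upwards [Ioc_mem_nhdsGT (zero_lt_one' ℝ)] with t ht using h1 t ht
    have h6 := abs_nonpos_iff.1 h5
    simpa [Nat.factorial_ne_zero] using h6

end Taylor

section AlongCurves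

variable {E : Type*} [AddCommGroup E] [Module ℝ E] [TopologicalSpace E]
  [IsTopologicalAddGroup E] [ContinuousSMul ℝ E] [LocallyConvexSpace ℝ E] [T2Space E]

/-- The Taylor coefficients of a curve at zero, without the constant term. -/
noncomputable def taylorCoeffs (l : ℕ) (c : ℝ → E) (j : Fin l) : E :=
  (((j : ℕ) + 1).factorial : ℝ)⁻¹ • deriv^[(j : ℕ) + 1] c 0

/-- The moment curve `t ↦ (t, t ^ 2, …, t ^ l)`. -/
def momentCurve (l : ℕ) (t : ℝ) (j : Fin l) : ℝ := t ^ ((j : ℕ) + 1)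

theorem contDiff_momentCurve (l : ℕ) : ContDiff ℝ (⊤ : ℕ∞) (momentCurve l) :=
  contDiff_pi.2 fun j => contDiff_id.pow ((j : ℕ) + 1)

/-- Mackey's theorem reduces this to the scalar Taylor estimate under each functional. -/
theorem isVonNBounded_taylor_remainder {c : ℝ → E} (hc : IsSmoothCurve c) (l : ℕ) :
    Bornology.IsVonNBounded ℝ (Set.range fun t : Set.Icc (0 : ℝ) 1 =>
      ((t : ℝ) ^ (l + 1))⁻¹ • (c t - (c 0 + sliceMap (taylorCoeffs l c) (momentCurve l t)))) := by
  refine (isVonNBounded_range_iff_dual _).2 fun L => ?_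
  obtain ⟨C, hC⟩ := exists_taylor_bound (isSmoothCurve_iff_contDiff.1 (hc.clm_comp L)) l
  refine ⟨|C|, fun ⟨t, ht⟩ => ?_⟩
  have h := hC t ht
  rw [Finset.sum_range_succ', ← Fin.sum_univ_eq_sum_range
    (fun j => (((j + 1).factorial : ℝ)⁻¹ * t ^ (j + 1)) * deriv^[j + 1] (fun t => L (c t)) 0)] at h
  simp only [hc.iterate_deriv_clm_comp L] at h
  have h1 : L (c t - (c 0 + sliceMap (taylorCoeffs l c) (momentCurve l t))) =
      L (c t) - (∑ j : Fin l, ((((j : ℕ) + 1).factorial : ℝ)⁻¹ * t ^ ((j : ℕ) + 1)) *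
        L (deriv^[(j : ℕ) + 1] c 0) + ((0 : ℕ).factorial : ℝ)⁻¹ * t ^ 0 * L (deriv^[0] c 0)) := by
    simp only [map_sub, map_add, sliceMap_apply, map_sum, map_smul, taylorCoeffs, momentCurve,
      smul_eq_mul]
    simp only [Nat.factorial_zero, Nat.cast_one, inv_one, pow_zero, one_mul,
      Function.iterate_zero_apply]
    rw [add_comm (L (c 0))]
    congr 2
    exact Finset.sum_congr rfl fun j _ => by ring
  rw [map_smul, smul_eq_mul, abs_mul, h1]
  -- At `t = 0` the convention `0⁻¹ = 0` makes the rescaled remainder vanish.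
  rcases ht.1.eq_or_lt with h0 | h0
  · simp [← h0]
  · rw [abs_inv, abs_of_pos (pow_pos h0 _), inv_mul_le_iff₀ (pow_pos h0 _), mul_comm _ |C|]
    exact h.trans (by gcongr; exact le_abs_self C)

/-- The derivative of order `l` of a smooth function along a curve depends only on the `l`-jet of
the curve. -/
theorem iterate_deriv_comp_eq_taylor (hE : ∀ K : Set E, IsCompact K → FastSequentiallyCompact K)
    {g : E → ℝ} (hg : ∀ c : ℝ → E, IsSmoothCurve c → IsSmoothCurve fun t => g (c t))
    {c : ℝ → E} (hc : IsSmoothCurve c) (l : ℕ) :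
    deriv^[l] (fun t => g (c t)) 0 =
      deriv^[l] (fun t => g (c 0 + sliceMap (taylorCoeffs l c) (momentCurve l t))) 0 := by
  set P : ℝ → E := fun t => c 0 + sliceMap (taylorCoeffs l c) (momentCurve l t) with hPdef
  have hP : IsSmoothCurve P := (isSmoothCurve_const (c 0)).add
    ((isSmoothCurve_iff_contDiff.2 (contDiff_momentCurve l)).clm_comp _)
  have hl : ∀ x w : E, IsSmoothCurve fun t : ℝ => g (x + t • w) :=
    fun x w => hg _ (isSmoothCurve_line x w)
  have hPc : Continuous P := hP.continuous_iterate_deriv 0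
  have hcc : Continuous c := hc.continuous_iterate_deriv 0
  -- A compact set containing every segment from `P t` to `c t`, so that the mean value inequality
  -- can be used along them.
  have hK := hE ((fun q : ℝ × ℝ => P q.1 + q.2 • (c q.1 - P q.1)) ''
    (Set.Icc 0 1 ×ˢ Set.Icc 0 1)) ((isCompact_Icc.prod isCompact_Icc).image (by fun_prop))
  obtain ⟨C, hC⟩ := exists_bound_pure_derivative (normSeminorm ℝ ℝ) (B := {g}) 1
    (by rintro _ rfl; exact hg) (fun c hc => by
      obtain ⟨C, hC⟩ := (isCompact_Icc (a := (0 : ℝ)) (b := 1)).exists_bound_of_continuousOn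
        ((hg c hc).continuous_iterate_deriv 1).continuousOn
      exact ⟨C, by rintro _ rfl; exact hC⟩) hK (isVonNBounded_taylor_remainder hc l)
  have hbound : ∀ t ∈ Set.Icc (0 : ℝ) 1, |g (c t) - g (P t)| ≤ C * t ^ (l + 1) := by
    intro t ht
    rcases ht.1.eq_or_lt with rfl | h0
    · have : P 0 = c 0 := by
        have hm : momentCurve l 0 = 0 := by funext j; simp [momentCurve]
        simp [hPdef, hm]
      simp [this]
    have hpos : 0 < t ^ (l + 1) := pow_pos h0 _
    -- Moving from `P t` for time `t ^ (l + 1)` in the direction `w` reaches `c t`, and `w` ranges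
    -- over a bounded set. This yields the order `t ^ (l + 1)`.
    set w := (t ^ (l + 1))⁻¹ • (c t - P t) with hw
    have hwt : c t - P t = t ^ (l + 1) • w := by rw [hw, smul_inv_smul₀ hpos.ne']
    have h := (convex_Icc (0 : ℝ) (t ^ (l + 1))).norm_image_sub_le_of_norm_hasDerivWithin_le
      (f := fun s : ℝ => g (P t + s • w)) (C := C) (fun s _ =>
      (hasDerivAt_line hl (P t) w s).hasDerivWithinAt) (fun s hs =>
      hC g rfl _ ⟨(t, s * (t ^ (l + 1))⁻¹), ⟨ht, ?_, ?_⟩, ?_⟩ w ⟨⟨t, ht⟩, rfl⟩)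
      (Set.left_mem_Icc.2 hpos.le) (Set.right_mem_Icc.2 hpos.le)
    · rw [← hwt, zero_smul, add_zero, add_sub_cancel, sub_zero, Real.norm_of_nonneg hpos.le] at h
      exact h
    · exact mul_nonneg hs.1 (inv_nonneg.2 hpos.le)
    · rw [← div_eq_mul_inv]
      exact div_le_one_of_le₀ hs.2 hpos.le
    · simp only [hw, smul_smul]
  have h1 := isSmoothCurve_iff_contDiff.1 (hg c hc)
  have h2 := isSmoothCurve_iff_contDiff.1 (hg P hP)
  have h3 := iterate_deriv_eq_zero_of_isBigO (h1.sub h2) hbound l le_rfl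
  rw [← iteratedDeriv_eq_iterate, iteratedDeriv_fun_sub
    (contDiff_infty.1 h1 l).contDiffAt (contDiff_infty.1 h2 l).contDiffAt, sub_eq_zero] at h3
  simpa only [iteratedDeriv_eq_iterate] using h3

theorem norm_multilinear_le_of_basis {l m : ℕ}
    (φ : ContinuousMultilinearMap ℝ (fun _ : Fin l => Fin m → ℝ) ℝ) {M : ℝ} (hM0 : 0 ≤ M)
    (hM : ∀ r : Fin l → Fin m, |φ fun i => Pi.single (r i) 1| ≤ M) :
    ‖φ‖ ≤ (m : ℝ) ^ l * M := by
  refine φ.opNorm_le_bound (by positivity) fun v => ?_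
  have hv : v = fun i => ∑ j, v i j • (Pi.single j 1 : Fin m → ℝ) := by
    funext i
    exact pi_eq_sum_univ' (v i)
  conv_lhs => rw [hv]
  rw [φ.map_sum]
  refine (norm_sum_le _ _).trans ?_
  calc _ ≤ ∑ _r : Fin l → Fin m, (∏ i, ‖v i‖) * M := by
        refine Finset.sum_le_sum fun r _ => ?_
        rw [φ.map_smul_univ (fun i => v i (r i)) (fun i => Pi.single (r i) 1), norm_smul, norm_prod]
        gcongr with i
        · exact norm_le_pi_norm _ _
        · exact hM r
    _ = _ := by
        rw [Finset.sum_const, Finset.card_univ, Fintype.card_fun, Fintype.card_fin,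
          Fintype.card_fin, nsmul_eq_mul]
        push_cast
        ring

/-- Bounds for the differentials on compact and bounded sets imply bounds along curves. -/
theorem exists_bound_along_curve (hE : ∀ K : Set E, IsCompact K → FastSequentiallyCompact K)
    {B : Set (E → ℝ)} (hB : ∀ g ∈ B, ∀ c : ℝ → E, IsSmoothCurve c → IsSmoothCurve fun t => g (c t))
    (hbd : ∀ (l : ℕ) (K W : Set E), IsCompact K → Bornology.IsVonNBounded ℝ W →
      ∃ M, ∀ g ∈ B, ∀ x ∈ K, ∀ w : Fin l → E, (∀ i, w i ∈ W) → |polarizedDerivative l g x w| ≤ M)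
    {c : ℝ → E} (hc : IsSmoothCurve c) (l : ℕ) (a b : ℝ) :
    ∃ C, ∀ g ∈ B, ∀ t ∈ Set.Icc a b, |deriv^[l] (fun t => g (c t)) t| ≤ C := by
  have hcc (n : ℕ) : Continuous (deriv^[n] c) := hc.continuous_iterate_deriv n
  -- All Taylor coefficients of `c` at all base points of the interval; a finite union of compact
  -- sets.
  set W : Set E := ⋃ j : Fin l, (fun t => (((j : ℕ) + 1).factorial : ℝ)⁻¹ •
    deriv^[(j : ℕ) + 1] c t) '' Set.Icc a b with hW
  have hWb : Bornology.IsVonNBounded ℝ W := by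
    refine IsCompact.isVonNBounded ℝ ?_
    exact isCompact_iUnion fun j => isCompact_Icc.image ((hcc _).const_smul _)
  choose M hM using fun i : ℕ => hbd i (c '' Set.Icc a b) W (isCompact_Icc.image (hcc 0)) hWb
  set M' : ℝ := ∑ i ∈ Finset.range (l + 1), (l : ℝ) ^ i * |M i| with hM'
  -- The summand `1` gives `D ≤ D ^ i` for `i ≥ 1`, the shape needed in the bound for a composition.
  set D : ℝ := 1 + ∑ i ∈ Finset.range (l + 1), ‖iteratedFDeriv ℝ i (momentCurve l) 0‖ with hD
  have hD1 : 1 ≤ D := le_add_of_nonneg_right (Finset.sum_nonneg fun _ _ => norm_nonneg _)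
  refine ⟨l.factorial * M' * D ^ l, fun g hg t ht => ?_⟩
  set d : ℝ → E := fun s => c (1 * s + t) with hd
  have hds : IsSmoothCurve d := hc.comp_affine one_ne_zero t
  have hd0 (n : ℕ) : deriv^[n] d 0 = deriv^[n] c t := by
    rw [hd, hc.iterate_deriv_comp_affine one_ne_zero]
    simp
  have h1 : deriv^[l] (fun t => g (c t)) t = deriv^[l] (fun s => g (d s)) 0 := by
    rw [hd, (hB g hg c hc).iterate_deriv_comp_affine one_ne_zero]
    simp
  have hd0' : d 0 = c t := by simp [hd]
  have hG := contDiff_slice (hB g hg) (d 0) (taylorCoeffs l d)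
  rw [h1, iterate_deriv_comp_eq_taylor hE (hB g hg) hds, ← iteratedDeriv_eq_iterate,
    ← Real.norm_eq_abs, ← norm_iteratedFDeriv_eq_norm_iteratedDeriv]
  -- On basis vectors, the derivatives of the slice at `0` are differentials of `g` at `c t`
  -- evaluated on Taylor coefficients, so the constant does not depend on `g` or `t`.
  refine norm_iteratedFDeriv_comp_le (g := fun s => g (d 0 + sliceMap (taylorCoeffs l d) s))
    (f := momentCurve l) hG (contDiff_momentCurve l) (by exact_mod_cast le_top) 0
    (fun i hi => ?_) (fun i hi1 hi => ?_)
  · have hm : momentCurve l 0 = 0 := by funext j; simp [momentCurve]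
    refine (norm_multilinear_le_of_basis _ (abs_nonneg (M i)) fun r => ?_).trans
      (Finset.single_le_sum (f := fun i => (l : ℝ) ^ i * |M i|) (fun _ _ => by positivity)
        (Finset.mem_range.2 (Nat.lt_succ_of_le hi)))
    rw [iteratedFDeriv_slice (hB g hg), hm, map_zero, add_zero, hd0']
    refine (hM i g hg _ ⟨t, ht, rfl⟩ _ fun k => ?_).trans (le_abs_self _)
    exact Set.mem_iUnion.2 ⟨r k, t, ht, by simp only [taylorCoeffs, hd0]⟩
  · refine le_trans ?_ (le_self_pow₀ hD1 (by omega))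
    refine (Finset.single_le_sum (f := fun i => ‖iteratedFDeriv ℝ i (momentCurve l) 0‖)
      (fun _ _ => norm_nonneg _) (Finset.mem_range.2 (Nat.lt_succ_of_le hi))).trans ?_
    exact le_add_of_nonneg_left zero_le_one

end AlongCurves

/-! ### Bounded sets of the (C)- and the (D)-topology -/

/-- Neighbourhoods of zero are generated by the sets where `Φ i x` maps `S` into `U`. By homogeneity
such a set absorbs `B` exactly when `U` absorbs all values taken on `S`. -/
theorem isVonNBounded_iInf_induced_uniformOnFun {X F ι : Type*} [AddCommGroup X] [Module ℝ X]
    [AddCommGroup F] [Module ℝ F] [UniformSpace F] [IsUniformAddGroup F]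
    {α : ι → Type*} (𝔖 : ∀ i, Set (Set (α i))) (Φ : ∀ i, X → α i → F)
    (hΦ : ∀ i (a : ℝ) x, Φ i (a • x) = a • Φ i x) (B : Set X) :
    @Bornology.IsVonNBounded ℝ X _ _ _ (⨅ i, TopologicalSpace.induced
      (fun x => UniformOnFun.ofFun (𝔖 i) (Φ i x)) inferInstance) B ↔
      ∀ i, ∀ S ∈ 𝔖 i, Bornology.IsVonNBounded ℝ (Set.image2 (Φ i) B S) := by
  have hΦ0 (i : ι) : Φ i 0 = 0 := by simpa using hΦ i 0 0
  have hbasis : (uniformity F).HasBasis (fun U : Set F => U ∈ 𝓝 0)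
      fun U => (fun q : F × F => q.2 - q.1) ⁻¹' U := by
    rw [uniformity_eq_comap_nhds_zero]
    exact (𝓝 (0 : F)).basis_sets.comap _
  have key (i : ι) (S : Set (α i)) (U : Set F) :
      Absorbs ℝ {x | ∀ a ∈ S, Φ i x a ∈ U} B ↔ Absorbs ℝ U (Set.image2 (Φ i) B S) := by
    simp only [absorbs_iff_eventually_cobounded_mapsTo, Set.MapsTo, Set.forall_mem_image2,
      Set.mem_ofPred_eq, hΦ, Pi.smul_apply]
  have hn (i : ι) : 𝓝 (UniformOnFun.ofFun (𝔖 i) (Φ i 0)) = _ :=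
    UniformOnFun.nhds_eq_of_basis _ _ hbasis _
  let _ : TopologicalSpace X := ⨅ i, TopologicalSpace.induced
    (fun x => UniformOnFun.ofFun (𝔖 i) (Φ i x)) inferInstance
  rw [Bornology.isVonNBounded_iff_absorbing_le, nhds_iInf, le_iInf_iff]
  refine forall_congr' fun i => ?_
  rw [nhds_induced, hn i]
  simp only [comap_iInf, comap_principal, le_iInf_iff, le_principal_iff]
  refine forall₂_congr fun S _ => ?_
  rw [Bornology.isVonNBounded_iff]
  refine forall₂_congr fun U _ => ?_
  rw [← key]
  simp only [hΦ0, UniformOnFun.toFun_ofFun, Set.mem_preimage, Pi.zero_apply, sub_zero,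
    Set.preimage_ofPred_eq, Filter.mem_absorbing]

section Unpack

variable {E : Type*} [AddCommGroup E] [Module ℝ E] [TopologicalSpace E]
  [IsTopologicalAddGroup E] [ContinuousSMul ℝ E] [T2Space E]
  {F : Type*} [AddCommGroup F] [Module ℝ F] [UniformSpace F]
  [IsUniformAddGroup F] [ContinuousSMul ℝ F] [T2Space F]

theorem isCBounded_iff (B : Set (SmoothMap E F)) :
    IsCBounded B ↔ ∀ c : ℝ → E, IsSmoothCurve c → ∀ (l : ℕ) (a b : ℝ),
      Bornology.IsVonNBounded ℝ (Set.image2 (fun (f : SmoothMap E F) (t : ℝ) =>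
        deriv^[l] (fun t => (f : E → F) (c t)) t) B (Set.Icc a b)) := by
  have h : cTopology E F = ⨅ q : SmoothCurve E × ℕ, TopologicalSpace.induced
      (fun f : SmoothMap E F => UniformOnFun.ofFun {I : Set ℝ | ∃ a b : ℝ, I = Set.Icc a b}
        (deriv^[q.2] (fun t => (f : E → F) ((q.1 : ℝ → E) t)))) inferInstance := by
    simp only [cTopology, smoothCurveTopology, induced_iInf, induced_compose, iInf_prod]
    rfl
  rw [IsCBounded, h, isVonNBounded_iInf_induced_uniformOnFun
    (fun _ : SmoothCurve E × ℕ => {I : Set ℝ | ∃ a b : ℝ, I = Set.Icc a b})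
    (fun q (f : SmoothMap E F) => deriv^[q.2] (fun t => (f : E → F) ((q.1 : ℝ → E) t)))
    (fun q a f => (f.2 q.1 q.1.2).iterate_deriv_smul a q.2)]
  constructor
  · exact fun h c hc l a b => h (⟨c, hc⟩, l) _ ⟨a, b, rfl⟩
  · rintro h ⟨c, l⟩ _ ⟨a, b, rfl⟩
    exact h c c.2 l a b

theorem isDBounded_iff [LocallyConvexSpace ℝ F] (B : Set (SmoothMap E F)) :
    IsDBounded B ↔ ∀ (l : ℕ) (K W : Set E), IsCompact K → Bornology.IsVonNBounded ℝ W →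
      Bornology.IsVonNBounded ℝ (Set.image2 (fun (f : SmoothMap E F) (p : E × (Fin l → E)) =>
        polarizedDerivative l (f : E → F) p.1 p.2) B (K ×ˢ {w | ∀ i, w i ∈ W})) := by
  have h : dTopology E F = ⨅ l : ℕ, TopologicalSpace.induced
      (fun f : SmoothMap E F => UniformOnFun.ofFun (compactTimesBounded E l)
        (fun p : E × (Fin l → E) => polarizedDerivative l (f : E → F) p.1 p.2)) inferInstance := by
    refine iInf_congr fun l => ?_
    congr 1
    funext f
    congr 1
    funext p
    exact iteratedDifferential_eq_polarizedDerivative f.2 l p.1 p.2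
  rw [IsDBounded, h, isVonNBounded_iInf_induced_uniformOnFun (fun l => compactTimesBounded E l)
    (fun l (f : SmoothMap E F) (p : E × (Fin l → E)) => polarizedDerivative l (f : E → F) p.1 p.2)
    (fun l a f => funext fun p => polarizedDerivative_smul f.2 a l p.1 p.2)]
  constructor
  · exact fun h l K W hK hW => h l _ ⟨K, W, hK, hW, rfl⟩
  · rintro h l _ ⟨K, W, hK, hW, rfl⟩
    exact h l K W hK hW

/-- The direction to (D) works with seminorms of `F`. The converse is tested on functionals, because
the jet argument is made for scalar functions. -/
theorem isCBounded_iff_isDBounded [LocallyConvexSpace ℝ E] [LocallyConvexSpace ℝ F]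
    (hE : ∀ K : Set E, IsCompact K → FastSequentiallyCompact K) (B : Set (SmoothMap E F)) :
    IsCBounded B ↔ IsDBounded B := by
  rw [isCBounded_iff, isDBounded_iff]
  constructor
  · refine fun h l K W hK hW => isVonNBounded_iff_seminorm.2 fun p hp => ?_
    obtain ⟨C, hC⟩ := exists_bound_polarizedDerivative p (B := (↑) '' B) l
      (by rintro _ ⟨f, -, rfl⟩; exact f.2) (fun c hc => by
        obtain ⟨C, hC⟩ := isVonNBounded_iff_seminorm.1 (h c hc l 0 1) p hp
        refine ⟨C, ?_⟩
        rintro _ ⟨f, hf, rfl⟩ t ht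
        exact hC _ ⟨f, hf, t, ht, rfl⟩) (hE K hK) hW
    refine ⟨C, ?_⟩
    rintro _ ⟨f, hf, ⟨x, w⟩, ⟨hx, hw⟩, rfl⟩
    exact hC f ⟨f, hf, rfl⟩ x hx w hw
  · refine fun h c hc l a b => ?_
    rw [← Set.image_uncurry_prod, ← Subtype.range_coe (s := _ '' _),
      isVonNBounded_range_iff_dual]
    intro L
    obtain ⟨C, hC⟩ := exists_bound_along_curve hE (B := (fun f : SmoothMap E F => fun x => L (f.1 x)) '' B)
      (by rintro _ ⟨f, -, rfl⟩ c hc; exact (f.2 c hc).clm_comp L) (fun l K W hK hW => by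
        obtain ⟨M, hM⟩ := isVonNBounded_iff_seminorm.1 (h l K W hK hW)
          ((normSeminorm ℝ ℝ).comp L.toLinearMap) (continuous_norm.comp L.continuous)
        refine ⟨M, ?_⟩
        rintro _ ⟨f, hf, rfl⟩ x hx w hw
        rw [polarizedDerivative_dual f.2]
        exact hM _ ⟨f, hf, (x, w), ⟨hx, hw⟩, rfl⟩) hc l a b
    refine ⟨C, ?_⟩
    rintro ⟨_, ⟨f, t⟩, ⟨hf, ht⟩, rfl⟩
    have := hC _ ⟨f, hf, rfl⟩ t ht
    have h1 := IsSmoothCurve.iterate_deriv_clm_comp (c := fun t => f.1 (c t)) (f.2 c hc) L l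
    exact (congrArg abs (congrFun h1 t)).symm.trans_le this

end Unpack

/-! ### Extension of continuous seminorms -/

section Extension

variable {X : Type*} [AddCommGroup X] [Module ℝ X] [TopologicalSpace X]
  [IsTopologicalAddGroup X] [ContinuousSMul ℝ X] [LocallyConvexSpace ℝ X]

/-- In a locally convex space, every neighbourhood of zero contains the open unit ball of a
continuous seminorm. -/
theorem exists_continuous_seminorm_of_mem_nhds_zero {U : Set X} (hU : U ∈ 𝓝 0) :
    ∃ q : Seminorm ℝ X, Continuous q ∧ ∀ v, q v < 1 → v ∈ U := by
  obtain ⟨⟨s, r⟩, hr, hs⟩ := (PolynormableSpace.withSeminorms ℝ X).hasBasis_zero_ball.mem_iff.1 hU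
  have hr : 0 < r := hr
  refine ⟨r⁻¹.toNNReal • s.sup _,
    Continuous.const_smul (Seminorm.continuous_finsetSup fun i _ => i.2) _, fun v hv => hs ?_⟩
  rw [Seminorm.mem_ball_zero]
  rwa [smul_apply, NNReal.smul_def, Real.coe_toNNReal _ (by positivity), smul_eq_mul,
    inv_mul_lt_iff₀ hr, mul_one] at hv

theorem continuous_of_continuous_seminorm_comp {Z : Type*} [AddCommGroup Z] [Module ℝ Z]
    [TopologicalSpace Z] [IsTopologicalAddGroup Z] (f : Z →ₗ[ℝ] X)
    (hf : ∀ p : Seminorm ℝ X, Continuous p → Continuous (p.comp f)) : Continuous f :=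
  (PolynormableSpace.withSeminorms ℝ X).continuous_of_continuous_comp f fun i => hf i.1 i.2

variable {Y : Type*} [AddCommGroup Y] [Module ℝ Y]

/-- The largest seminorm on `X` which is dominated by `q` and whose composition with `ι` is
dominated by `p`. -/
noncomputable def infConvolution (ι : Y →ₗ[ℝ] X) (p : Seminorm ℝ Y) (q : Seminorm ℝ X) :
    Seminorm ℝ X :=
  Seminorm.of (fun x => ⨅ y, p y + q (x - ι y))
    (fun x x' => by
      refine le_ciInf_add_ciInf fun y y' => ?_
      refine (ciInf_le ⟨0, ?_⟩ (y + y')).trans ?_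
      · rintro _ ⟨y, rfl⟩
        positivity
      · have h1 := map_add_le_add p y y'
        have h2 := map_add_le_add q (x - ι y) (x' - ι y')
        rw [sub_add_sub_comm, ← map_add] at h2
        linarith)
    (fun a x => by
      obtain rfl | ha := eq_or_ne a 0
      · rw [norm_zero, zero_mul, zero_smul]
        refine le_antisymm ((ciInf_le ⟨0, ?_⟩ 0).trans_eq (by simp))
          (Real.iInf_nonneg fun y => by positivity)
        rintro _ ⟨y, rfl⟩
        positivity
      · simp_rw [Real.mul_iInf_of_nonneg (norm_nonneg a), mul_add, ← map_smul_eq_mul q,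
          smul_sub]
        refine Function.Surjective.iInf_congr ((a⁻¹ • ·) : Y → Y)
          (fun u => ⟨a • u, inv_smul_smul₀ ha u⟩) fun u => ?_
        rw [map_smul ι, smul_inv_smul₀ ha, ← map_smul_eq_mul p, smul_inv_smul₀ ha])

/-- A continuous seminorm extends along a topological embedding into a locally convex space, and
the extension can be made large at a given point outside the closure of the subspace. -/
theorem exists_seminorm_extension [TopologicalSpace Y] {ι : Y →ₗ[ℝ] X} (hι : IsInducing ι)
    {p : Seminorm ℝ Y} (hp : Continuous p) (z : X) (M : ℝ) :
    ∃ q : Seminorm ℝ X, Continuous q ∧ q.comp ι = p ∧ (z ∉ closure (Set.range ι) → M ≤ q z) := by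
  obtain ⟨q₀, hq₀, hpq₀⟩ := Seminorm.exists_le_comp_of_isInducing hp hι
  -- The two summands have separate tasks: `q₀` dominates `p` on `Y`, so the infimum restricts to
  -- exactly `p`, while `q₁` keeps `z` at distance at least `M` from the subspace.
  obtain ⟨q₁, hq₁, hz⟩ : ∃ q₁ : Seminorm ℝ X, Continuous q₁ ∧
      (z ∉ closure (Set.range ι) → ∀ y, M ≤ q₁ (z - ι y)) := by
    by_cases hz : z ∈ closure (Set.range ι)
    · exact ⟨q₀, hq₀, fun h => (h hz).elim⟩
    have hU : (fun v => z - v) ⁻¹' (closure (Set.range ι))ᶜ ∈ 𝓝 0 := by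
      refine (continuous_const.sub continuous_id).continuousAt.preimage_mem_nhds ?_
      simpa using isClosed_closure.isOpen_compl.mem_nhds hz
    obtain ⟨q₂, hq₂, hU⟩ := exists_continuous_seminorm_of_mem_nhds_zero hU
    refine ⟨M.toNNReal • q₂, hq₂.const_smul _, fun _ y => ?_⟩
    have h1 : 1 ≤ q₂ (z - ι y) := by
      by_contra! h
      refine hU _ h ?_
      change z - (z - ι y) ∈ _
      rw [sub_sub_cancel]
      exact subset_closure ⟨y, rfl⟩
    change M ≤ M.toNNReal * q₂ (z - ι y)
    exact (Real.le_coe_toNNReal M).trans (le_mul_of_one_le_right (by positivity) h1)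
  have hbdd (x : X) : BddBelow (Set.range fun y => p y + (q₀ + q₁) (x - ι y)) := by
    refine ⟨0, ?_⟩
    rintro _ ⟨y, rfl⟩
    positivity
  refine ⟨infConvolution ι p (q₀ + q₁), ?_, ?_, fun h => ?_⟩
  · refine Seminorm.continuous_of_le (q := q₀ + q₁) (hq₀.add hq₁) fun x => ?_
    exact (ciInf_le (hbdd x) 0).trans_eq (by simp)
  · ext y
    refine le_antisymm ((ciInf_le (hbdd (ι y)) y).trans_eq (by simp)) (le_ciInf fun u => ?_)
    have h1 := map_add_le_add p u (y - u)
    have h2 : p (y - u) ≤ q₀ (ι (y - u)) := hpq₀ (y - u)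
    have h3 := apply_nonneg q₁ (ι (y - u))
    rw [add_sub_cancel] at h1
    rw [← map_sub]
    change _ ≤ p u + (q₀ (ι (y - u)) + q₁ (ι (y - u)))
    linarith
  · refine le_ciInf fun u => ?_
    change _ ≤ p u + (q₀ (z - ι u) + q₁ (z - ι u))
    have h1 := apply_nonneg p u
    have h2 := apply_nonneg q₀ (z - ι u)
    linarith [hz h u]

end Extension

/-- A complete subspace of a Hausdorff space is closed. -/
theorem isClosed_range_of_isInducing {X Y : Type*} [AddCommGroup X] [Module ℝ X]
    [TopologicalSpace X] [IsTopologicalAddGroup X] [T2Space X] [AddCommGroup Y] [Module ℝ Y]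
    [TopologicalSpace Y] [IsTopologicalAddGroup Y]
    (hY : @CompleteSpace Y (IsTopologicalAddGroup.rightUniformSpace Y)) {ι : Y →ₗ[ℝ] X}
    (hι : IsInducing ι) : IsClosed (Set.range ι) := by
  let : UniformSpace Y := IsTopologicalAddGroup.rightUniformSpace Y
  let : UniformSpace X := IsTopologicalAddGroup.rightUniformSpace X
  have : IsUniformAddGroup Y := isUniformAddGroup_of_addCommGroup
  have : IsUniformAddGroup X := isUniformAddGroup_of_addCommGroup
  have h : IsUniformInducing ι := AddMonoidHom.isUniformInducing_of_isInducing (f := ι) hι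
  exact ((completeSpace_iff_isComplete_range h).1 hY).isClosed

/-! ### Compact subsets of Fréchet spaces and (LF)-spaces -/

section StrictInductiveLimit

variable {E : Type*} [AddCommGroup E] [Module ℝ E]
  {Y : ℕ → Type*} [∀ n, AddCommGroup (Y n)] [∀ n, Module ℝ (Y n)]
  {ι : ∀ n, Y n →ₗ[ℝ] Y (n + 1)} {j : ∀ n, Y n →ₗ[ℝ] E}

theorem monotone_range (hjι : ∀ n, j (n + 1) ∘ₗ ι n = j n) :
    Monotone fun n => Set.range (j n) := by
  refine monotone_nat_of_le_succ fun n => ?_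
  rintro _ ⟨y, rfl⟩
  exact ⟨ι _ y, LinearMap.congr_fun (hjι n) y⟩

/-- Compatible seminorms on the steps of an inductive limit define a seminorm on the limit. -/
theorem exists_seminorm_of_compatible (hj : ∀ n, Function.Injective (j n))
    (hjι : ∀ n, j (n + 1) ∘ₗ ι n = j n) (hE : ∀ x, ∃ n, x ∈ Set.range (j n))
    (p : ∀ n, Seminorm ℝ (Y n)) (hp : ∀ n, (p (n + 1)).comp (ι n) = p n) :
    ∃ P : Seminorm ℝ E, ∀ n, P.comp (j n) = p n := by
  have lift (m k : ℕ) (y : Y m) : ∃ y' : Y (m + k), j _ y' = j m y ∧ p _ y' = p m y := by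
    induction k with
    | zero => exact ⟨y, rfl, rfl⟩
    | succ k ih =>
      obtain ⟨y', h1, h2⟩ := ih
      exact ⟨ι _ y', (LinearMap.congr_fun (hjι _) y').trans h1,
        (DFunLike.congr_fun (hp _) y').trans h2⟩
  have lift' {m n : ℕ} (hmn : m ≤ n) (y : Y m) : ∃ y' : Y n, j n y' = j m y ∧ p n y' = p m y := by
    obtain ⟨k, rfl⟩ := Nat.exists_eq_add_of_le hmn
    exact lift m k y
  choose N y hy using hE
  -- The value does not depend on the chosen step and representative: lift both to a common step,
  -- where injectivity identifies them.
  have key (n : ℕ) (u : Y n) : p (N (j n u)) (y (j n u)) = p n u := by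
    obtain ⟨u₁, h1, h2⟩ := lift' (le_max_left n (N (j n u))) u
    obtain ⟨u₂, h3, h4⟩ := lift' (le_max_right n (N (j n u))) (y (j n u))
    rw [← h2, ← h4, hj _ (h3.trans ((hy _).trans h1.symm))]
  refine ⟨Seminorm.of (fun x => p (N x) (y x)) (fun x x' => ?_) (fun a x => ?_),
    fun n => Seminorm.ext (key n)⟩
  · obtain ⟨u₁, h1, h2⟩ := lift' (le_max_left (N x) (N x')) (y x)
    obtain ⟨u₂, h3, h4⟩ := lift' (le_max_right (N x) (N x')) (y x')
    rw [hy] at h1 h3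
    have h5 := key _ (u₁ + u₂)
    rw [map_add, h1, h3] at h5
    rw [h5, ← h2, ← h4]
    exact map_add_le_add _ _ _
  · have h5 := key _ (a • y x)
    rw [map_smul, hy] at h5
    rw [h5, map_smul_eq_mul]

variable [TopologicalSpace E] [∀ n, TopologicalSpace (Y n)] [∀ n, IsTopologicalAddGroup (Y n)]
  [∀ n, ContinuousSMul ℝ (Y n)] [∀ n, LocallyConvexSpace ℝ (Y n)]

/-- In a strict inductive limit, continuous seminorms extend from the first step to the limit, and
the extension can be made large at one point of each step outside the closure of the previous
step. -/
theorem exists_seminorm_on_limit (hι : ∀ n, IsInducing (ι n)) (hj : ∀ n, Function.Injective (j n))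
    (hjι : ∀ n, j (n + 1) ∘ₗ ι n = j n) (hE : ∀ x, ∃ n, x ∈ Set.range (j n))
    (hfin : ∀ P : Seminorm ℝ E, (∀ n, Continuous (P.comp (j n))) → Continuous P)
    {p : Seminorm ℝ (Y 0)} (hp : Continuous p) (z : ∀ n, Y (n + 1)) (M : ℕ → ℝ) :
    ∃ P : Seminorm ℝ E, Continuous P ∧ P.comp (j 0) = p ∧
      ∀ n, z n ∉ closure (Set.range (ι n)) → M n ≤ P (j (n + 1) (z n)) := by
  choose! f hf using fun n (q : Seminorm ℝ (Y n)) (hq : Continuous q) =>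
    exists_seminorm_extension (hι n) hq (z n) (M n)
  let p' : ∀ n, Seminorm ℝ (Y n) := fun n => Nat.rec p (fun n q => f n q) n
  have hp' (n : ℕ) : Continuous (p' n) := by
    induction n with
    | zero => exact hp
    | succ n ih => exact (hf n _ ih).1
  obtain ⟨P, hP⟩ := exists_seminorm_of_compatible hj hjι hE p' fun n => (hf n _ (hp' n)).2.1
  refine ⟨P, hfin P fun n => by rw [hP]; exact hp' n, hP 0, fun n hz => ?_⟩
  have h := DFunLike.congr_fun (hP (n + 1)) (z n)
  exact ((hf n _ (hp' n)).2.2 hz).trans_eq h.symm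

/-- The steps of a strict inductive limit are topologically embedded in the limit. -/
theorem isInducing_of_strict [IsTopologicalAddGroup E] (hι : ∀ n, IsInducing (ι n))
    (hj : ∀ n, Function.Injective (j n))
    (hjι : ∀ n, j (n + 1) ∘ₗ ι n = j n) (hE : ∀ x, ∃ n, x ∈ Set.range (j n))
    (hjc : ∀ n, Continuous (j n))
    (hfin : ∀ P : Seminorm ℝ E, (∀ n, Continuous (P.comp (j n))) → Continuous P) (N : ℕ) :
    IsInducing (j N) := by
  have hdown (P : Seminorm ℝ E) (h : ∀ n, Continuous (P.comp (j (N + n)))) (n : ℕ) :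
      Continuous (P.comp (j n)) := by
    obtain hn | hn := le_total N n
    · obtain ⟨k, rfl⟩ := Nat.exists_eq_add_of_le hn
      exact h k
    · refine Nat.decreasingInduction (motive := fun n _ => Continuous (P.comp (j n)))
        (fun n _ ih => ?_) (h 0) hn
      rw [← hjι n]
      exact ih.comp (hι n).continuous
  have hseminorm (p : Seminorm ℝ (Y N)) (hp : Continuous p) :
      ∃ P : Seminorm ℝ E, Continuous P ∧ P.comp (j N) = p := by
    -- The extension is built from the first step, so the sequence is restarted at `N`; `hdown`
    -- shows that discarding the earlier steps is harmless.
    obtain ⟨P, hP, hPp, -⟩ := exists_seminorm_on_limit (Y := fun n => Y (N + n))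
      (ι := fun n => ι (N + n)) (j := fun n => j (N + n)) (fun n => hι _) (fun n => hj _)
      (fun n => hjι _) (fun x => (hE x).imp fun n hx => monotone_range hjι (Nat.le_add_left n N) hx)
      (fun P h => hfin P (hdown P h)) hp 0 0
    exact ⟨P, hP, hPp⟩
  -- The nontrivial inequality: every continuous seminorm on the step is a restriction from `E`, so
  -- it is continuous for the induced topology.
  refine isInducing_iff _ |>.2 (le_antisymm (hjc N).le_induced ?_)
  rw [← continuous_id_iff_le]
  refine @continuous_of_continuous_seminorm_comp (Y N) _ _ _ _ _ _ (Y N) _ _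
    (TopologicalSpace.induced (j N) ‹_›) (topologicalAddGroup_induced (j N)) LinearMap.id
    fun p hp => ?_
  obtain ⟨P, hP, rfl⟩ := hseminorm p hp
  exact @Continuous.comp (Y N) E ℝ (_) _ _ (j N) P hP continuous_induced_dom

/-- A bounded subset of a strict inductive limit with closed steps is contained in one of the
steps. -/
theorem exists_subset_range_of_isVonNBounded [IsTopologicalAddGroup E] [ContinuousSMul ℝ E]
    [LocallyConvexSpace ℝ E] (hι : ∀ n, IsInducing (ι n)) (hιc : ∀ n, IsClosed (Set.range (ι n)))
    (hj : ∀ n, Function.Injective (j n))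
    (hjι : ∀ n, j (n + 1) ∘ₗ ι n = j n) (hE : ∀ x, ∃ n, x ∈ Set.range (j n))
    (hfin : ∀ P : Seminorm ℝ E, (∀ n, Continuous (P.comp (j n))) → Continuous P) {K : Set E}
    (hK : Bornology.IsVonNBounded ℝ K) : ∃ N, K ⊆ Set.range (j N) := by
  by_contra! hN
  -- `z n` is a point of `K` new at step `n + 1`, if there is one, and an arbitrary vector
  -- otherwise.
  have hz (n : ℕ) : ∃ z : Y (n + 1), (∃ z : Y (n + 1), j _ z ∈ K ∧ z ∉ Set.range (ι n)) →
      j _ z ∈ K ∧ z ∉ Set.range (ι n) := by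
    by_cases h : ∃ z : Y (n + 1), j _ z ∈ K ∧ z ∉ Set.range (ι n)
    · exact ⟨h.choose, fun _ => h.choose_spec⟩
    · exact ⟨0, fun h' => (h h').elim⟩
  choose z hz using hz
  obtain ⟨P, hP, -, hPz⟩ := exists_seminorm_on_limit hι hj hjι hE hfin
    (p := 0) continuous_zero z (fun n => n)
  obtain ⟨C, hC⟩ := isVonNBounded_iff_seminorm.1 hK P hP
  obtain ⟨m, hm⟩ := exists_nat_gt C
  -- A new point at step `n + 1` forces `n ≤ P ≤ C < m` there, so no point of `K` is new beyond step
  -- `m`.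
  have hex (n : ℕ) : ∀ x ∈ K, x ∈ Set.range (j n) → x ∈ Set.range (j m) := by
    induction n with
    | zero => exact fun x _ hx => monotone_range hjι (Nat.zero_le m) hx
    | succ n ih =>
      rintro x hxK ⟨y, rfl⟩
      by_cases hy : y ∈ Set.range (ι n)
      · obtain ⟨y, rfl⟩ := hy
        exact ih _ hxK ⟨y, (LinearMap.congr_fun (hjι n) y).symm⟩
      · obtain ⟨h1, h2⟩ := hz n ⟨y, hxK, hy⟩
        have h3 := (hPz n (by rwa [(hιc n).closure_eq])).trans (hC _ h1)
        have h4 : n < m := by exact_mod_cast h3.trans_lt hm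
        exact monotone_range hjι (Nat.succ_le_of_lt h4) ⟨y, rfl⟩
  obtain ⟨x, hxK, hx⟩ := Set.not_subset.1 (hN m)
  obtain ⟨n, hn⟩ := hE x
  exact hx (hex n x hxK hn)

/-- Compact subsets of a strict inductive limit of complete metrizable steps are fast sequentially
compact. -/
theorem IsCompact.fastSequentiallyCompact_of_strict [IsTopologicalAddGroup E] [ContinuousSMul ℝ E]
    [LocallyConvexSpace ℝ E] [∀ n, FirstCountableTopology (Y n)] [∀ n, T2Space (Y n)]
    (hY : ∀ n, @CompleteSpace (Y n) (IsTopologicalAddGroup.rightUniformSpace (Y n)))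
    (hι : ∀ n, IsInducing (ι n)) (hj : ∀ n, Function.Injective (j n))
    (hjι : ∀ n, j (n + 1) ∘ₗ ι n = j n) (hE : ∀ x, ∃ n, x ∈ Set.range (j n))
    (hjc : ∀ n, Continuous (j n))
    (hfin : ∀ P : Seminorm ℝ E, (∀ n, Continuous (P.comp (j n))) → Continuous P) {K : Set E}
    (hK : IsCompact K) : FastSequentiallyCompact K := by
  obtain ⟨N, hN⟩ := exists_subset_range_of_isVonNBounded hι
    (fun n => isClosed_range_of_isInducing (hY n) (hι n)) hj hjι hE hfin (hK.isVonNBounded ℝ)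
  have hK' : IsCompact (j N ⁻¹' K) := by
    rw [(isInducing_of_strict hι hj hjι hE hjc hfin N).isCompact_iff,
      Set.image_preimage_eq_of_subset hN]
    exact hK
  intro y hy
  choose u hu using fun n => hN (hy n)
  obtain ⟨x, φ, hφ, hb⟩ := IsCompact.fastSequentiallyCompact hK' u fun n => by
    rw [Set.mem_preimage, hu]; exact hy n
  refine ⟨j N x, φ, hφ, ?_⟩
  have h := hb.image (⟨j N, hjc N⟩ : Y N →L[ℝ] E)
  rw [← Set.range_comp] at h
  refine (congrArg _ (congrArg Set.range (funext fun n => ?_))).mp h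
  simp [hu]

end StrictInductiveLimit

/-- Every seminorm is continuous for a locally convex topology which is coarse enough that a linear
map into it is continuous as soon as its composition with the seminorm is. -/
theorem exists_isLocallyConvexTopology_of_seminorm.{u, v} {E : Type u} [AddCommGroup E] [Module ℝ E]
    (P : Seminorm ℝ E) :
    ∃ t : TopologicalSpace E, IsLocallyConvexTopology E t ∧ @Continuous E ℝ t _ P ∧
      ∀ {Y : Type v} [AddCommGroup Y] [Module ℝ Y] [TopologicalSpace Y] [IsTopologicalAddGroup Y]
        (f : Y →ₗ[ℝ] E), Continuous (P.comp f) → @Continuous Y E _ t f := by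
  let i : SeminormedAddCommGroup E := P.toAddGroupSeminorm.toSeminormedAddCommGroup
  let _ : NormedSpace ℝ E :=
    { ‹Module ℝ E› with norm_smul_le := fun r x => (map_smul_eq_mul P r x).le }
  refine ⟨i.toPseudoMetricSpace.toUniformSpace.toTopologicalSpace,
    ⟨inferInstance, inferInstance, inferInstance⟩, continuous_norm (E := E), fun f hf => ?_⟩
  refine continuous_of_continuousAt_zero f ?_
  rw [ContinuousAt, map_zero, tendsto_zero_iff_norm_tendsto_zero]
  exact hf.tendsto' 0 0 (map_zero _)

/-! ### Application to the (LF) and Fréchet topologies of the statement -/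

section LFSpace

variable {E : Type*} [AddCommGroup E] [Module ℝ E] [tE : TopologicalSpace E]

theorem IsLFTopology.fastSequentiallyCompact (h : IsLFTopology E tE) {K : Set E}
    (hK : IsCompact K) : FastSequentiallyCompact K := by
  obtain ⟨S, hS, τ, hE, hF, hτ, ⟨_, _, _⟩, hc, hfin⟩ := h
  have h1 (n : ℕ) := (hF n).isTopologicalAddGroup
  have h2 (n : ℕ) := (hF n).continuousSMul
  have h3 (n : ℕ) := (hF n).locallyConvexSpace
  have h4 (n : ℕ) := (hF n).metrizableSpace
  have h5 (n : ℕ) : @FirstCountableTopology (S n) (τ n) := @TopologicalSpace.PseudoMetrizableSpace.firstCountableTopology _ (τ n) _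
  have h6 (n : ℕ) : @T2Space (S n) (τ n) := @TopologicalSpace.t2Space_of_metrizableSpace _ (τ n) _
  refine @IsCompact.fastSequentiallyCompact_of_strict E _ _ (fun n => S n) _ _
    (fun n => Submodule.inclusion (hS n.le_succ)) (fun n => (S n).subtype) tE τ h1 h2 h3 _ _ _ h5 h6
    (fun n => (hF n).completeSpace) (fun n => (@isInducing_iff _ _ (τ n) (τ (n + 1)) _).2 (hτ n))
    (fun n => Subtype.val_injective) (fun n => rfl)
    (fun x => (hE x).imp fun n hx => ⟨⟨x, hx⟩, rfl⟩) hc (fun P hP => ?_) K hK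
  -- The topology of the single seminorm `P`, Hausdorff or not, competes in the definition of the
  -- finest locally convex topology, so `E` is finer and `P` is continuous on it.
  obtain ⟨t, ht, hPt, htf⟩ := exists_isLocallyConvexTopology_of_seminorm P
  exact continuous_le_dom (hfin t ht fun n => @htf (S n) _ _ (τ n) (h1 n) _ (hP n)) hPt

theorem IsFrechetTopology.fastSequentiallyCompact (h : IsFrechetTopology E tE) {K : Set E}
    (hK : IsCompact K) : FastSequentiallyCompact K := by
  have := h.isTopologicalAddGroup
  have := h.continuousSMul
  have := h.metrizableSpace
  exact IsCompact.fastSequentiallyCompact hK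

end LFSpace

end ConvenientCalculus

theorem mainTheorem13
    {E : Type*} [AddCommGroup E] [Module ℝ E] [tE : TopologicalSpace E]
    [IsTopologicalAddGroup E] [ContinuousSMul ℝ E] [LocallyConvexSpace ℝ E] [T2Space E]
    {F : Type*} [AddCommGroup F] [Module ℝ F] [UniformSpace F]
    [IsUniformAddGroup F] [ContinuousSMul ℝ F] [LocallyConvexSpace ℝ F] [T2Space F]
    (hE : ConvenientCalculus.IsFrechetTopology E tE ∨ ConvenientCalculus.IsLFTopology E tE) :
    (∀ B : Set (ConvenientCalculus.SmoothMap E F),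
      ConvenientCalculus.IsCBounded B → ConvenientCalculus.IsDBounded B) ∧
    (∀ B : Set (ConvenientCalculus.SmoothMap E F),
      ConvenientCalculus.IsCBounded B ↔ ConvenientCalculus.IsDBounded B) := by
  have key := ConvenientCalculus.isCBounded_iff_isDBounded (E := E) (F := F) fun K hK =>
    hE.elim (fun h => h.fastSequentiallyCompact hK) (fun h => h.fastSequentiallyCompact hK)
  exact ⟨fun B => (key B).1, key⟩
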